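/- Let $F$ be a nonarchimedean local field, $E/F$ a finite Galois extension with residue degree $f$, and $W_E\subset W_F$ the Weil groups with respect to a common separable closure. Let $n\ge 1$, let $\rho$ be a continuous unitary character of $W_F$, and regard $\phi=\rho\oplus\cdots\oplus\rho$ ($n$ summands, trivial on $\mathrm{SL}(2,\mathbb{C})$) as a Langlands parameter $W_F\times \mathrm{SL}(2,\mathbb{C})\to \mathrm{GL}(n,\mathbb{C})$. Let $\mathcal{O}^t_F(\rho)$ be its compact orbit: the set of $\mathrm{GL}(n,\mathbb{C})$-conjugacy classes of the parameters $\psi_1\rho\oplus\cdots\oplus\psi_n\rho$ with $\psi_1,\dots,\psi_n$ unramified unitary characters of $W_F$, with the quotient topology from the space of $n$-tuples $(\psi_1,\dots,\psi_n)$ (unramified unitary characters carry the compact-open topology). Under the local Langlands correspondence it parametrizes a compact component of the unitary principal series of $\mathrm{GL}(n,F)$. Base change $BC$, the restriction of parameters from $W_F\times\mathrm{SL}(2,\mathbb{C})$ to $W_E\times\mathrm{SL}(2,\mathbb{C})$, is a continuous map $\mathcal{O}^t_F(\rho)\to\mathcal{O}^t_E(\rho|_{W_E})$. Let $\Phi_F\in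 W_F$ and $\Phi_E\in W_E$ be geometric Frobenius elements (these exist). Then $$[\psi_1\rho\oplus\cdots\oplus\psi_n\rho]\mapsto[\psi_1(\Phi_F),\dots,\psi_n(\Phi_F)],\qquad \theta_F:\mathcal{O}^t_F(\rho)\to\mathbb{T}^n/S_n,$$ is a homeomorphism, and so is the map $\theta_E:\mathcal{O}^t_E(\rho|_{W_E})\to\mathbb{T}^n/S_n$ defined in the same way with $\Phi_E$. In these coordinates base change is $$\mathbb{T}^n/S_n\to\mathbb{T}^n/S_n,\qquad [z_1,\dots,z_n]\mapsto[z_1^f,\dots,z_n^f].$$ The product map $h:\mathbb{T}^n/S_n\to\mathbb{T}$, $[z_1,\dots,z_n]\mapsto z_1\cdots z_n$, is a homotopy equivalence, $K^1(\mathbb{T})\cong\mathbb{Z}$, and $K^0(\mathbb{T})\cong\mathbb{Z}$ is generated by the class of the trivial line bundle. The maps $(h\theta_F)^*$ and $(h\theta_E)^*$ are bijective on $K^0$ and $K^1$, so they identify the groups $K^j$ of both compact orbits with $K^j(\mathbb{T})\cong\mathbb{Z}$. Under these identifications: (i) on $K^1$, base change induces multiplication by $f$: $BC^*\,(h\theta_E)^*\alpha=f\cdot(h\theta_F)^*\alpha$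 for all $\alpha\in K^1(\mathbb{T})$; (ii) on $K^0$, base change induces the identity: $BC^*\,(h\theta_E)^*\alpha=(h\theta_F)^*\alpha$ for all $\alpha\in K^0(\mathbb{T})$. -/

import Mathlib

noncomputable section

set_option linter.unusedSectionVars false

namespace BaseChangeK

open ValuativeRel
open scoped MatrixGroups

/-! ## Topological K-theory -/

section KZero

variable {R : Type*} [CommRing R]

/-- Two square matrices `e`, `f` are algebraically equivalent if `e = a * b` and `f = b * a`. For
idempotent matrices of continuous functions this says that the bundles `im e` and `im f` are
isomorphic. -/
def IdemEquiv {p q : Type*} [Fintype p] [Fintype q] (e : Matrix p p R) (f : Matrix q q R) : Prop :=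
  ∃ (a : Matrix p q R) (b : Matrix q p R), a * b = e ∧ b * a = f

namespace IdemEquiv

variable {p q r s : Type*} [Fintype p] [Fintype q] [Fintype r] [Fintype s]

theorem refl (e : Matrix p p R) (he : e * e = e) : IdemEquiv e e := ⟨e, e, he, he⟩

theorem symm {e : Matrix p p R} {f : Matrix q q R} (h : IdemEquiv e f) : IdemEquiv f e := by
  obtain ⟨a, b, h1, h2⟩ := h
  exact ⟨b, a, h2, h1⟩

theorem trans {e : Matrix p p R} {f : Matrix q q R} {g : Matrix r r R} (he : e * e = e)
    (hg : g * g = g) (h : IdemEquiv e f) (h' : IdemEquiv f g) : IdemEquiv e g := by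
  obtain ⟨a, b, h1, h2⟩ := h
  obtain ⟨c, d, h3, h4⟩ := h'
  refine ⟨a * c, d * b, ?_, ?_⟩
  · calc a * c * (d * b) = a * (c * d) * b := by simp only [Matrix.mul_assoc]
      _ = (a * b) * (a * b) := by rw [h3, ← h2]; simp only [Matrix.mul_assoc]
      _ = e := by rw [h1, he]
  · calc d * b * (a * c) = d * (b * a) * c := by simp only [Matrix.mul_assoc]
      _ = (d * c) * (d * c) := by rw [h2, ← h3]; simp only [Matrix.mul_assoc]
      _ = g := by rw [h4, hg]

theorem submatrix (e : Matrix p p R) (he : e * e = e) (σ : q ≃ p) :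
    IdemEquiv e (e.submatrix σ σ) := by
  refine ⟨e.submatrix id σ, e.submatrix σ id, ?_, ?_⟩
  · rw [Matrix.submatrix_mul_equiv, he, Matrix.submatrix_id_id]
  · have := Matrix.submatrix_mul_equiv e e σ (Equiv.refl p) σ
    simp only [Equiv.coe_refl] at this
    rw [this, he]

theorem blocks {e : Matrix p p R} {f : Matrix q q R} {e' : Matrix r r R} {f' : Matrix s s R}
    (h : IdemEquiv e e') (h' : IdemEquiv f f') :
    IdemEquiv (Matrix.fromBlocks e 0 0 f) (Matrix.fromBlocks e' 0 0 f') := by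
  obtain ⟨a, b, h1, h2⟩ := h
  obtain ⟨c, d, h3, h4⟩ := h'
  refine ⟨Matrix.fromBlocks a 0 0 c, Matrix.fromBlocks b 0 0 d, ?_, ?_⟩ <;>
    simp [Matrix.fromBlocks_multiply, *]

theorem map {S : Type*} [CommRing S] (φ : R →+* S) {e : Matrix p p R} {f : Matrix q q R}
    (h : IdemEquiv e f) : IdemEquiv (e.map φ) (f.map φ) := by
  obtain ⟨a, b, h1, h2⟩ := h
  exact ⟨a.map φ, b.map φ, by rw [← Matrix.map_mul, h1], by rw [← Matrix.map_mul, h2]⟩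

end IdemEquiv

/-- Idempotent square matrices of arbitrary finite size. -/
structure IdemMatrix (R : Type*) [CommRing R] where
  size : ℕ
  mat : Matrix (Fin size) (Fin size) R
  idem : mat * mat = mat

theorem blocks_idem {p q : Type*} [Fintype p] [Fintype q] {e : Matrix p p R} {f : Matrix q q R}
    (he : e * e = e) (hf : f * f = f) :
    Matrix.fromBlocks e 0 0 f * Matrix.fromBlocks e 0 0 f = Matrix.fromBlocks e 0 0 f := by
  simp [Matrix.fromBlocks_multiply, *]

namespace IdemMatrix

instance setoid (R : Type*) [CommRing R] : Setoid (IdemMatrix R) where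
  r e f := IdemEquiv e.mat f.mat
  iseqv :=
    { refl := fun e => .refl e.mat e.idem
      symm := fun h => h.symm
      trans := fun {e _ g} h h' => .trans e.idem g.idem h h' }

/-- The block sum of two idempotent matrices. -/
def sum (e f : IdemMatrix R) : IdemMatrix R where
  size := e.size + f.size
  mat := (Matrix.fromBlocks e.mat 0 0 f.mat).submatrix finSumFinEquiv.symm finSumFinEquiv.symm
  idem := by rw [Matrix.submatrix_mul_equiv, blocks_idem e.idem f.idem]

theorem sum_equiv (e f : IdemMatrix R) :
    IdemEquiv (Matrix.fromBlocks e.mat 0 0 f.mat) (e.sum f).mat :=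
  .submatrix _ (blocks_idem e.idem f.idem) _

/-- The zero matrix of size zero. -/
def zero (R : Type*) [CommRing R] : IdemMatrix R := ⟨0, 0, by simp⟩

/-- The unit matrix of size one. -/
def one (R : Type*) [CommRing R] : IdemMatrix R := ⟨1, 1, by simp⟩

/-- The image of an idempotent matrix under a ring homomorphism. -/
def map {S : Type*} [CommRing S] (φ : R →+* S) (e : IdemMatrix R) : IdemMatrix S :=
  ⟨e.size, e.mat.map φ, by rw [← Matrix.map_mul, e.idem]⟩

end IdemMatrix

/-- The monoid `V(R)` of equivalence classes of idempotent matrices under block sum. -/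
def VMonoid (R : Type*) [CommRing R] : Type _ := Quotient (IdemMatrix.setoid R)

namespace VMonoid

instance : Zero (VMonoid R) := ⟨Quotient.mk _ (IdemMatrix.zero R)⟩

instance : Add (VMonoid R) :=
  ⟨Quotient.map₂ IdemMatrix.sum (by
    intro e e' h f f' h'
    exact ((e.sum_equiv f).symm.trans (e.sum f).idem (blocks_idem e'.idem f'.idem)
      (IdemEquiv.blocks h h')).trans (e.sum f).idem (e'.sum f').idem (e'.sum_equiv f'))⟩

instance : AddCommMonoid (VMonoid R) where
  nsmul := nsmulRec
  add_assoc := by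
    rintro ⟨e⟩ ⟨f⟩ ⟨g⟩
    refine Quotient.sound ?_
    have h1 : IdemEquiv ((e.sum f).sum g).mat
        (Matrix.fromBlocks (Matrix.fromBlocks e.mat 0 0 f.mat) 0 0 g.mat) :=
      ((e.sum f).sum_equiv g).symm.trans ((e.sum f).sum g).idem
        (blocks_idem (blocks_idem e.idem f.idem) g.idem)
        (.blocks (e.sum_equiv f).symm (.refl _ g.idem))
    have h2 : IdemEquiv (Matrix.fromBlocks e.mat 0 0 (Matrix.fromBlocks f.mat 0 0 g.mat))
        (e.sum (f.sum g)).mat :=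
      (IdemEquiv.blocks (.refl _ e.idem) (f.sum_equiv g)).trans
        (blocks_idem e.idem (blocks_idem f.idem g.idem)) (e.sum (f.sum g)).idem
        (e.sum_equiv (f.sum g))
    have h3 := IdemEquiv.submatrix
      (Matrix.fromBlocks (Matrix.fromBlocks e.mat 0 0 f.mat) 0 0 g.mat)
      (blocks_idem (blocks_idem e.idem f.idem) g.idem) (Equiv.sumAssoc _ _ _).symm
    have h4 : (Matrix.fromBlocks (Matrix.fromBlocks e.mat 0 0 f.mat) 0 0 g.mat).submatrix
        (Equiv.sumAssoc _ _ _).symm (Equiv.sumAssoc _ _ _).symm =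
        Matrix.fromBlocks e.mat 0 0 (Matrix.fromBlocks f.mat 0 0 g.mat) := by
      ext (i | i | i) (j | j | j) <;> rfl
    rw [h4] at h3
    exact (h1.trans ((e.sum f).sum g).idem (blocks_idem e.idem (blocks_idem f.idem g.idem)) h3).trans
      ((e.sum f).sum g).idem (e.sum (f.sum g)).idem h2
  zero_add := by
    rintro ⟨e⟩
    refine Quotient.sound ?_
    have h3 := IdemEquiv.submatrix e.mat e.idem (Equiv.emptySum (Fin 0) (Fin e.size))
    have h4 : e.mat.submatrix (Equiv.emptySum (Fin 0) (Fin e.size))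
        (Equiv.emptySum (Fin 0) (Fin e.size)) =
        Matrix.fromBlocks (IdemMatrix.zero R).mat 0 0 e.mat := by
      ext (i | i) (j | j)
      · exact i.elim0
      · exact i.elim0
      · exact j.elim0
      · rfl
    rw [h4] at h3
    exact (((IdemMatrix.zero R).sum_equiv e).symm.trans
      ((IdemMatrix.zero R).sum e).idem e.idem h3.symm)
  add_zero := by
    rintro ⟨e⟩
    refine Quotient.sound ?_
    have h3 := IdemEquiv.submatrix e.mat e.idem (Equiv.sumEmpty (Fin e.size) (Fin 0))
    have h4 : e.mat.submatrix (Equiv.sumEmpty (Fin e.size) (Fin 0))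
        (Equiv.sumEmpty (Fin e.size) (Fin 0)) =
        Matrix.fromBlocks e.mat 0 0 (IdemMatrix.zero R).mat := by
      ext (i | i) (j | j)
      · rfl
      · exact j.elim0
      · exact i.elim0
      · exact i.elim0
    rw [h4] at h3
    exact ((e.sum_equiv (IdemMatrix.zero R)).symm.trans
      (e.sum (IdemMatrix.zero R)).idem e.idem h3.symm)
  add_comm := by
    rintro ⟨e⟩ ⟨f⟩
    refine Quotient.sound ?_
    have h3 := IdemEquiv.submatrix (Matrix.fromBlocks e.mat 0 0 f.mat)
      (blocks_idem e.idem f.idem) (Equiv.sumComm (Fin f.size) (Fin e.size))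
    have h4 : (Matrix.fromBlocks e.mat 0 0 f.mat).submatrix
        (Equiv.sumComm (Fin f.size) (Fin e.size)) (Equiv.sumComm (Fin f.size) (Fin e.size)) =
        Matrix.fromBlocks f.mat 0 0 e.mat := by
      ext (i | i) (j | j) <;> rfl
    rw [h4] at h3
    exact ((e.sum_equiv f).symm.trans (e.sum f).idem (blocks_idem f.idem e.idem) h3).trans
      (e.sum f).idem (f.sum e).idem (f.sum_equiv e)

/-- Functoriality of `V`. -/
def map {S : Type*} [CommRing S] (φ : R →+* S) : VMonoid R →+ VMonoid S where
  toFun := Quotient.map (IdemMatrix.map φ) (fun _ _ h => IdemEquiv.map φ h)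
  map_zero' := by
    refine Quotient.sound ?_
    have : (IdemMatrix.zero R).map φ = IdemMatrix.zero S := by
      simp only [IdemMatrix.map, IdemMatrix.zero]
      congr 1
      exact Subsingleton.elim _ _
    rw [this]
  map_add' := by
    rintro ⟨e⟩ ⟨f⟩
    refine Quotient.sound ?_
    have : (e.sum f).map φ = (e.map φ).sum (f.map φ) := by
      simp only [IdemMatrix.map, IdemMatrix.sum]
      congr 1
      ext i j
      simp only [Matrix.map_apply, Matrix.submatrix_apply]
      rcases finSumFinEquiv.symm i with i | i <;> rcases finSumFinEquiv.symm j with j | j <;>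
        first | rfl | exact map_zero φ
    rw [this]

end VMonoid

end KZero

/-- `K⁰(X)` for a compact Hausdorff space `X`: the Grothendieck group of the monoid of isomorphism
classes of complex vector bundles on `X`, a bundle being presented as the image of an idempotent
matrix over `C(X)` and the sum being the direct sum. -/
abbrev KZero (X : Type*) [TopologicalSpace X] : Type _ :=
  Algebra.GrothendieckAddGroup (VMonoid C(X, ℂ))

/-- The class of the trivial line bundle in `K⁰(X)`. -/
def KZero.one (X : Type*) [TopologicalSpace X] : KZero X :=
  Algebra.GrothendieckAddGroup.of (Quotient.mk _ (IdemMatrix.one C(X, ℂ)) : VMonoid C(X, ℂ))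

/-- Pull-back of vector bundles, `f^* : K⁰(Y) → K⁰(X)`. -/
def KZero.map {X Y : Type*} [TopologicalSpace X] [TopologicalSpace Y] (f : C(X, Y)) :
    KZero Y →+ KZero X :=
  Algebra.GrothendieckAddGroup.lift
    (Algebra.GrothendieckAddGroup.of.comp
      (VMonoid.map (ContinuousMap.compRightAlgHom ℂ ℂ f).toRingHom))

section KOne

/-- The subgroup of null-homotopic maps in the group of continuous maps from `X` to a topological
group `G`. -/
def nullHomotopic (X G : Type*) [TopologicalSpace X] [TopologicalSpace G] [Group G]
    [IsTopologicalGroup G] : Subgroup C(X, G) where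
  carrier := {u | u.Homotopic 1}
  one_mem' := .refl _
  mul_mem' := by
    intro u v hu hv
    have := (ContinuousMap.Homotopic.refl (⟨fun p : G × G => p.1 * p.2, continuous_mul⟩ :
      C(G × G, G))).comp (hu.prodMk hv)
    have h1 : (⟨fun p : G × G => p.1 * p.2, continuous_mul⟩ : C(G × G, G)).comp
        ((1 : C(X, G)).prodMk 1) = 1 := by
      ext x
      simp
    rw [h1] at this
    exact this
  inv_mem' := by
    intro u hu
    have := (ContinuousMap.Homotopic.refl (⟨fun p : G => p⁻¹, continuous_inv⟩ : C(G, G))).comp hu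
    have h1 : (⟨fun p : G => p⁻¹, continuous_inv⟩ : C(G, G)).comp 1 = (1 : C(X, G)) := by
      ext x
      simp
    rw [h1] at this
    exact this

instance (X G : Type*) [TopologicalSpace X] [TopologicalSpace G] [Group G]
    [IsTopologicalGroup G] : (nullHomotopic X G).Normal where
  conj_mem := by
    intro u hu g
    have := (ContinuousMap.Homotopic.refl (⟨fun p : G × G => p.1 * p.2 * p.1⁻¹, by fun_prop⟩ :
      C(G × G, G))).comp ((ContinuousMap.Homotopic.refl g).prodMk hu)
    have h1 : (⟨fun p : G × G => p.1 * p.2 * p.1⁻¹, by fun_prop⟩ : C(G × G, G)).comp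
        (g.prodMk 1) = 1 := by
      ext x
      simp
    rw [h1] at this
    exact this

/-- The group `[X, G]` of homotopy classes of continuous maps from `X` to `G`. -/
abbrev HomotopyClassGroup (X G : Type*) [TopologicalSpace X] [TopologicalSpace G] [Group G]
    [IsTopologicalGroup G] : Type _ := C(X, G) ⧸ nullHomotopic X G

/-- Functoriality of `[X, G]` in `G`. -/
def HomotopyClassGroup.mapRight (X : Type*) {G H : Type*} [TopologicalSpace X] [TopologicalSpace G]
    [Group G] [IsTopologicalGroup G] [TopologicalSpace H] [Group H] [IsTopologicalGroup H]
    (φ : G →ₜ* H) : HomotopyClassGroup X G →* HomotopyClassGroup X H :=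
  QuotientGroup.map _ _
    ({ toFun := fun u => (φ : C(G, H)).comp u
       map_one' := by ext x; simp
       map_mul' := fun u v => by ext x; simp } : C(X, G) →* C(X, H))
    (by
      intro u hu
      have := (ContinuousMap.Homotopic.refl (φ : C(G, H))).comp hu
      have h1 : (φ : C(G, H)).comp (1 : C(X, G)) = 1 := by
        ext x
        simp
      rw [h1] at this
      exact this)

/-- Functoriality of `[X, G]` in `X`. -/
def HomotopyClassGroup.mapLeft {X Y : Type*} (G : Type*) [TopologicalSpace X] [TopologicalSpace Y]
    [TopologicalSpace G] [Group G] [IsTopologicalGroup G] (f : C(X, Y)) :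
    HomotopyClassGroup Y G →* HomotopyClassGroup X G :=
  QuotientGroup.map _ _
    ({ toFun := fun u => u.comp f
       map_one' := by ext x; simp
       map_mul' := fun u v => by ext x; simp } : C(Y, G) →* C(X, G))
    (by
      intro u hu
      have := ContinuousMap.Homotopic.comp hu (ContinuousMap.Homotopic.refl f)
      exact this)

/-- The matrix `A ⊕ 1` of size `M`, for a square matrix `A` of size `N ≤ M`. -/
def padMatrix {N : ℕ} (M : ℕ) (A : Matrix (Fin N) (Fin N) ℂ) : Matrix (Fin M) (Fin M) ℂ :=
  Matrix.of fun i j =>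
    if h : i.1 < N ∧ j.1 < N then A ⟨i, h.1⟩ ⟨j, h.2⟩ else if i = j then 1 else 0

theorem padMatrix_self {N : ℕ} (A : Matrix (Fin N) (Fin N) ℂ) : padMatrix N A = A := by
  ext i j
  simp [padMatrix]

theorem padMatrix_padMatrix {N M L : ℕ} (h : N ≤ M) (A : Matrix (Fin N) (Fin N) ℂ) :
    padMatrix L (padMatrix M A) = padMatrix L A := by
  ext i j
  simp only [padMatrix, Matrix.of_apply, Fin.ext_iff]
  split_ifs <;> first | rfl | omega

theorem padMatrix_one {N : ℕ} (M : ℕ) : padMatrix M (1 : Matrix (Fin N) (Fin N) ℂ) = 1 := by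
  ext i j
  simp only [padMatrix, Matrix.of_apply, Matrix.one_apply, Fin.ext_iff]
  split_ifs <;> rfl

theorem padMatrix_mul {N M : ℕ} (h : N ≤ M) (A B : Matrix (Fin N) (Fin N) ℂ) :
    padMatrix M (A * B) = padMatrix M A * padMatrix M B := by
  obtain ⟨k, rfl⟩ := Nat.exists_eq_add_of_le h
  have key : ∀ A : Matrix (Fin N) (Fin N) ℂ, padMatrix (N + k) A =
      (Matrix.fromBlocks A 0 0 1).submatrix finSumFinEquiv.symm finSumFinEquiv.symm := by
    intro A
    ext i j
    refine Fin.addCases (fun i => ?_) (fun i => ?_) i <;>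
      refine Fin.addCases (fun j => ?_) (fun j => ?_) j
    · simp [padMatrix]
    · have h1 : i.1 ≠ N + j.1 := by omega
      simp [padMatrix, Fin.ext_iff, h1]
    · have h1 : N + i.1 ≠ j.1 := by omega
      simp [padMatrix, Fin.ext_iff, h1]
    · simp [padMatrix, Matrix.one_apply]
  rw [key, key, key, Matrix.submatrix_mul_equiv, Matrix.fromBlocks_multiply]
  simp

theorem continuous_padMatrix {N : ℕ} (M : ℕ) :
    Continuous (padMatrix M : Matrix (Fin N) (Fin N) ℂ → _) := by
  refine continuous_matrix fun i j => ?_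
  simp only [padMatrix, Matrix.of_apply]
  split_ifs with h
  · exact continuous_id.matrix_elem _ _
  · exact continuous_const
  · exact continuous_const

/-- The stabilisation map `GL_N(ℂ) → GL_M(ℂ)`, `g ↦ g ⊕ 1`, for `N ≤ M`. -/
def stabilise {N M : ℕ} (h : N ≤ M) : GL (Fin N) ℂ →ₜ* GL (Fin M) ℂ where
  toMonoidHom := Units.map
    { toFun := padMatrix M
      map_one' := padMatrix_one M
      map_mul' := padMatrix_mul h }
  continuous_toFun := Continuous.units_map _ (continuous_padMatrix M)

/-- The transition maps `[X, GL_N(ℂ)] → [X, GL_M(ℂ)]`. -/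
abbrev stabiliseClass (X : Type*) [TopologicalSpace X] (N M : ℕ) (h : N ≤ M) :
    HomotopyClassGroup X (GL (Fin N) ℂ) →* HomotopyClassGroup X (GL (Fin M) ℂ) :=
  HomotopyClassGroup.mapRight X (stabilise h)

instance (X : Type*) [TopologicalSpace X] :
    DirectedSystem (fun N : ℕ => HomotopyClassGroup X (GL (Fin N) ℂ))
      (fun N M h => stabiliseClass X N M h) where
  map_self := by
    rintro N ⟨u⟩
    refine congrArg (QuotientGroup.mk) ?_
    ext x : 1
    refine Units.ext ?_
    exact padMatrix_self _
  map_map := by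
    rintro M L N h h' ⟨u⟩
    refine congrArg (QuotientGroup.mk) ?_
    ext x : 1
    refine Units.ext ?_
    exact padMatrix_padMatrix h _

/-- `K¹(X)` for a compact Hausdorff space `X`: the direct limit of the groups `[X, GL_N(ℂ)]` along
`g ↦ g ⊕ 1`, written additively. -/
def KOne (X : Type*) [TopologicalSpace X] : Type _ :=
  Additive (DirectLimit (fun N : ℕ => HomotopyClassGroup X (GL (Fin N) ℂ))
    (fun N M h => stabiliseClass X N M h))

instance (X : Type*) [TopologicalSpace X] : AddGroup (KOne X) :=
  inferInstanceAs (AddGroup (Additive (DirectLimit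
    (fun N : ℕ => HomotopyClassGroup X (GL (Fin N) ℂ)) (fun N M h => stabiliseClass X N M h))))

/-- Pull-back `f^* : K¹(Y) → K¹(X)`. -/
def KOne.map {X Y : Type*} [TopologicalSpace X] [TopologicalSpace Y] (f : C(X, Y)) :
    KOne Y →+ KOne X :=
  MonoidHom.toAdditive (MonoidHom.mk'
    (DirectLimit.map (fun N M h => stabiliseClass Y N M h) (fun N M h => stabiliseClass X N M h)
      (fun N => HomotopyClassGroup.mapLeft (GL (Fin N) ℂ) f)
      (by rintro N M h ⟨u⟩; rfl))
    (by
      refine DirectLimit.induction₂ _ fun N u v => ?_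
      simp only [DirectLimit.mul_def, DirectLimit.map_def, map_mul]))

end KOne

/-! ## Weil groups -/

section Weil

/-- The ring of elements of `Ω` that are integral over `O`. -/
def integers (O Ω : Type*) [CommRing O] [Field Ω] [Algebra O Ω] : Subring Ω :=
  (integralClosure O Ω).toSubring

/-- The maximal ideal of a local subring of `Ω`, as a set of elements of `Ω`. It is written as the
Jacobson radical, so that no proof of locality is needed. -/
def maxIdealSet {Ω : Type*} [Field Ω] (R : Subring Ω) : Set Ω :=
  Subtype.val '' (Ring.jacobson R : Set R)

/-- The residue ring of `O`; for a local ring this is the residue field. -/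
abbrev Residue (O : Type*) [CommRing O] : Type _ := O ⧸ Ring.jacobson O

/-- The cardinality of the residue field of `O`. -/
def residueCard (O : Type*) [CommRing O] : ℕ := Nat.card (Residue O)

variable (O K Ω : Type*) [CommRing O] [Field K] [Field Ω] [Algebra O K] [Algebra K Ω] [Algebra O Ω]
  [IsScalarTower O K Ω]

theorem map_mem_integers (σ : Gal(Ω/K)) {x : Ω} (hx : x ∈ integers O Ω) : σ x ∈ integers O Ω :=
  IsIntegral.map (σ.toAlgHom.restrictScalars O) hx

/-- `(σ x)^(q^a) ≡ x^(q^b)` for all integral `x`, that is, `σ` acts on the residue field of `Ω` as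
the power `b - a` of the `q`-Frobenius map. -/
def ActsAsFrob (σ : Gal(Ω/K)) (a b : ℕ) : Prop :=
  ∀ x ∈ integers O Ω,
    σ x ^ residueCard O ^ a - x ^ residueCard O ^ b ∈ maxIdealSet (integers O Ω)

variable {K Ω} in
theorem maxIdealSet_add {R : Subring Ω} {x y : Ω} (hx : x ∈ maxIdealSet R)
    (hy : y ∈ maxIdealSet R) : x + y ∈ maxIdealSet R := by
  obtain ⟨x, hx, rfl⟩ := hx
  obtain ⟨y, hy, rfl⟩ := hy
  exact ⟨x + y, add_mem hx hy, rfl⟩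

variable {K Ω} in
theorem maxIdealSet_neg {R : Subring Ω} {x y : Ω} (hx : x - y ∈ maxIdealSet R) :
    y - x ∈ maxIdealSet R := by
  obtain ⟨z, hz, h⟩ := hx
  exact ⟨-z, neg_mem hz, by rw [← neg_sub x y, ← h]; rfl⟩

variable {K Ω} in
theorem maxIdealSet_pow {R : Subring Ω} {x y : Ω} (hxR : x ∈ R) (hyR : y ∈ R)
    (hx : x - y ∈ maxIdealSet R) (n : ℕ) : x ^ n - y ^ n ∈ maxIdealSet R := by
  obtain ⟨z, hz, h⟩ := hx
  obtain ⟨c, hc⟩ := sub_dvd_pow_sub_pow (⟨x, hxR⟩ : R) ⟨y, hyR⟩ n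
  have hz' : z = (⟨x, hxR⟩ : R) - ⟨y, hyR⟩ := Subtype.ext h
  refine ⟨z * c, Ideal.mul_mem_right _ _ hz, ?_⟩
  rw [hz', ← hc]
  rfl

variable {O K Ω} in
theorem ActsAsFrob.mul {σ τ : Gal(Ω/K)} {a b c d : ℕ} (h : ActsAsFrob O K Ω σ a b)
    (h' : ActsAsFrob O K Ω τ c d) : ActsAsFrob O K Ω (σ * τ) (a + c) (b + d) := by
  intro x hx
  have hτ := map_mem_integers O K Ω τ hx
  have hσ := map_mem_integers O K Ω σ hτ
  have h1 := maxIdealSet_pow (pow_mem hσ _) (pow_mem hτ _) (h _ hτ) (residueCard O ^ c)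
  have h2 := maxIdealSet_pow (pow_mem hτ _) (pow_mem hx _) (h' _ hx) (residueCard O ^ b)
  have h3 := maxIdealSet_add h1 h2
  simp only [← pow_mul, ← pow_add] at h3
  rw [add_comm c b, sub_add_sub_cancel, add_comm d b] at h3
  exact h3

variable {O K Ω} in
theorem ActsAsFrob.inv {σ : Gal(Ω/K)} {a b : ℕ} (h : ActsAsFrob O K Ω σ a b) :
    ActsAsFrob O K Ω σ⁻¹ b a := by
  intro x hx
  have := h _ (map_mem_integers O K Ω σ⁻¹ hx)
  rw [← AlgEquiv.mul_apply, mul_inv_cancel, AlgEquiv.one_apply] at this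
  exact maxIdealSet_neg this

theorem actsAsFrob_one : ActsAsFrob O K Ω 1 0 0 := fun x _ => ⟨0, zero_mem _, by simp⟩

/-- The elements of the Galois group that act on the residue field of `Ω` as an integral power of
the `q`-Frobenius map. -/
def weilSubgroup : Subgroup Gal(Ω/K) where
  carrier := {σ | ∃ a b, ActsAsFrob O K Ω σ a b}
  one_mem' := ⟨0, 0, actsAsFrob_one O K Ω⟩
  mul_mem' := fun ⟨_, _, h⟩ ⟨_, _, h'⟩ => ⟨_, _, h.mul h'⟩
  inv_mem' := fun ⟨_, _, h⟩ => ⟨_, _, h.inv⟩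

/-- The Weil group of the nonarchimedean local field `K` with ring of integers `O`, with respect to
the separable closure `Ω` of `K`. -/
def WeilGroup : Type _ := weilSubgroup O K Ω

instance : Group (WeilGroup O K Ω) := inferInstanceAs (Group (weilSubgroup O K Ω))

/-- The inclusion of the Weil group into the Galois group. -/
def WeilGroup.toGal : WeilGroup O K Ω →* Gal(Ω/K) := (weilSubgroup O K Ω).subtype

/-- The inertia group: the elements that act trivially on the residue field of `Ω`. -/
def inertia : Subgroup (WeilGroup O K Ω) where
  carrier := {w | ActsAsFrob O K Ω (WeilGroup.toGal O K Ω w) 0 0}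
  one_mem' := by
    change ActsAsFrob O K Ω _ 0 0
    rw [map_one]
    exact actsAsFrob_one O K Ω
  mul_mem' := by
    intro v w h h'
    change ActsAsFrob O K Ω _ 0 0
    rw [map_mul]
    exact ActsAsFrob.mul h h'
  inv_mem' := by
    intro v h
    change ActsAsFrob O K Ω _ 0 0
    rw [map_inv]
    exact ActsAsFrob.inv h

/-- The topology of the Weil group, for which the inertia group is open and carries the Krull
topology: the coarsest one that makes the inclusion into the Galois group and the projection to
the discrete set of cosets of the inertia group continuous. -/
instance : TopologicalSpace (WeilGroup O K Ω) :=
  TopologicalSpace.induced (WeilGroup.toGal O K Ω) (krullTopology K Ω) ⊓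
    TopologicalSpace.induced (fun w => (w : WeilGroup O K Ω ⧸ inertia O K Ω)) ⊥

theorem WeilGroup.continuous_toGal : Continuous (WeilGroup.toGal O K Ω) :=
  continuous_iff_le_induced.2 inf_le_left

theorem WeilGroup.continuous_mk : @Continuous _ _ _ ⊥
    (fun w : WeilGroup O K Ω => (w : WeilGroup O K Ω ⧸ inertia O K Ω)) :=
  letI : TopologicalSpace (WeilGroup O K Ω ⧸ inertia O K Ω) := ⊥
  continuous_iff_le_induced.2 inf_le_right

/-- Geometric Frobenius elements: the inverse acts on the residue field of `Ω` as `x ↦ x^q`. -/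
def IsGeomFrob (w : WeilGroup O K Ω) : Prop := ActsAsFrob O K Ω (WeilGroup.toGal O K Ω w) 1 0

end Weil

section Restriction

variable (F E Ω : Type*) [Field F] [ValuativeRel F] [TopologicalSpace F]
  [IsNonarchimedeanLocalField F] [Field E] [Algebra F E] [FiniteDimensional F E]
  [Algebra.IsSeparable F E] [Field Ω] [Algebra F Ω] [Algebra E Ω] [IsScalarTower F E Ω]

/-- The ring of integers of the finite extension `E` of the local field `F`. -/
abbrev ringOfIntegers : Type _ := integralClosure 𝒪[F] E

theorem jacobson_le_comap :
    Ring.jacobson 𝒪[F] ≤ (Ring.jacobson (ringOfIntegers F E)).comap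
      (algebraMap 𝒪[F] (ringOfIntegers F E)) := by
  intro x hx
  rw [Ideal.mem_comap, Ring.jacobson_eq_sInf_isMaximal, Ideal.mem_sInf]
  intro M hM
  have hM' : M.IsMaximal := hM
  have : (M.comap (algebraMap 𝒪[F] (ringOfIntegers F E))).IsMaximal :=
    Ideal.isMaximal_comap_of_isIntegral_of_isMaximal M
  exact Ring.jacobson_le_of_isMaximal (M.comap (algebraMap 𝒪[F] (ringOfIntegers F E))) hx

/-- The inclusion of the residue field of `F` into the residue field of `E`. -/
def residueMap : Residue 𝒪[F] →+* Residue (ringOfIntegers F E) :=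
  Ideal.quotientMap _ (algebraMap 𝒪[F] (ringOfIntegers F E)) (jacobson_le_comap F E)

/-- The residue degree `f(E/F)`. -/
def residueDegree : ℕ :=
  letI := (residueMap F E).toAlgebra
  Module.finrank (Residue 𝒪[F]) (Residue (ringOfIntegers F E))

theorem residueCard_ringOfIntegers :
    residueCard (ringOfIntegers F E) = residueCard 𝒪[F] ^ residueDegree F E := by
  let := (residueMap F E).toAlgebra
  have : (Ring.jacobson 𝒪[F]).IsMaximal := by
    rw [IsLocalRing.ringJacobson_eq_maximalIdeal]
    infer_instance
  let : Field (Residue 𝒪[F]) := Ideal.Quotient.field _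
  have : Module.Finite 𝒪[F] (ringOfIntegers F E) :=
    IsIntegralClosure.finite 𝒪[F] F E (ringOfIntegers F E)
  have : IsScalarTower 𝒪[F] (Residue 𝒪[F]) (Residue (ringOfIntegers F E)) :=
    IsScalarTower.of_algebraMap_eq fun x => rfl
  have : Module.Finite 𝒪[F] (Residue (ringOfIntegers F E)) :=
    Module.Finite.of_surjective
      (Ideal.Quotient.mkₐ 𝒪[F] (Ring.jacobson (ringOfIntegers F E))).toLinearMap
      Ideal.Quotient.mk_surjective
  have : Module.Finite (Residue 𝒪[F]) (Residue (ringOfIntegers F E)) :=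
    Module.Finite.of_restrictScalars_finite 𝒪[F] _ _
  exact Module.natCard_eq_pow_finrank (K := Residue 𝒪[F])

theorem integers_ringOfIntegers : integers (ringOfIntegers F E) Ω = integers 𝒪[F] Ω := by
  ext x
  change IsIntegral _ x ↔ IsIntegral _ x
  exact ⟨fun h => isIntegral_trans (R := 𝒪[F]) x h, fun h => h.tower_top⟩

variable {F E Ω} in
theorem ActsAsFrob.restrict {σ : Gal(Ω/E)} {a b : ℕ}
    (h : ActsAsFrob (ringOfIntegers F E) E Ω σ a b) :
    ActsAsFrob 𝒪[F] F Ω (σ.restrictScalars F) (residueDegree F E * a) (residueDegree F E * b) := by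
  intro x hx
  rw [← integers_ringOfIntegers F E Ω] at hx ⊢
  have := h x hx
  rw [residueCard_ringOfIntegers, ← pow_mul, ← pow_mul] at this
  exact this

theorem continuous_restrictScalarsHom :
    Continuous (AlgEquiv.restrictScalarsHom F : Gal(Ω/E) →* Gal(Ω/F)) := by
  refine continuous_of_continuousAt_one _ ?_
  rw [ContinuousAt, map_one]
  intro s hs
  rw [krullTopology_mem_nhds_one_iff] at hs
  obtain ⟨L, hL, hs⟩ := hs
  rw [Filter.mem_map, krullTopology_mem_nhds_one_iff]
  let b := Module.finBasis F L
  refine ⟨IntermediateField.adjoin E (Set.range fun i => (b i : Ω)), ?_, ?_⟩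
  · refine IntermediateField.finiteDimensional_adjoin ?_
    rintro _ ⟨i, rfl⟩
    have h1 : IsIntegral F (b i : Ω) := (IsIntegral.of_finite F (b i)).map L.val
    exact h1.tower_top
  · intro σ hσ
    refine hs ?_
    rintro ⟨x, hx⟩
    have hx' : (x : Ω) = ∑ i, (b.repr ⟨x, hx⟩ i) • (b i : Ω) := by
      have h2 := congrArg L.val (b.sum_repr ⟨x, hx⟩)
      rw [map_sum] at h2
      exact h2.symm
    change σ.restrictScalars F x = x
    rw [hx', map_sum]
    refine Finset.sum_congr rfl fun i _ => ?_
    rw [map_smul]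
    congr 1
    exact hσ ⟨b i, IntermediateField.subset_adjoin _ _ ⟨i, rfl⟩⟩

/-- The inclusion `W_E → W_F` as a homomorphism of groups. -/
def weilInclusionHom : WeilGroup (ringOfIntegers F E) E Ω →* WeilGroup 𝒪[F] F Ω where
  toFun w := ⟨(WeilGroup.toGal _ E Ω w).restrictScalars F, by
    obtain ⟨a, b, h⟩ := w.2
    exact ⟨_, _, ActsAsFrob.restrict h⟩⟩
  map_one' := rfl
  map_mul' _ _ := rfl

theorem weilInclusionHom_mem_inertia {w : WeilGroup (ringOfIntegers F E) E Ω}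
    (hw : w ∈ inertia (ringOfIntegers F E) E Ω) :
    weilInclusionHom F E Ω w ∈ inertia 𝒪[F] F Ω :=
  ActsAsFrob.restrict (a := 0) (b := 0) hw

/-- The inclusion `W_E → W_F` of Weil groups, given by restriction of scalars in the Galois
groups. -/
def weilInclusion : WeilGroup (ringOfIntegers F E) E Ω →ₜ* WeilGroup 𝒪[F] F Ω where
  toMonoidHom := weilInclusionHom F E Ω
  continuous_toFun := by
    refine continuous_inf_rng.2 ⟨continuous_induced_rng.2 ?_, continuous_induced_rng.2 ?_⟩
    · exact (continuous_restrictScalarsHom F E Ω).comp (WeilGroup.continuous_toGal _ E Ω)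
    · let g : WeilGroup (ringOfIntegers F E) E Ω ⧸ inertia (ringOfIntegers F E) E Ω →
          WeilGroup 𝒪[F] F Ω ⧸ inertia 𝒪[F] F Ω :=
        Quotient.lift (fun w => (weilInclusionHom F E Ω w : WeilGroup 𝒪[F] F Ω ⧸ inertia 𝒪[F] F Ω))
          (by
            intro v w h
            rw [QuotientGroup.eq, ← map_inv, ← map_mul]
            exact weilInclusionHom_mem_inertia F E Ω (QuotientGroup.leftRel_apply.1 h))
      exact @Continuous.comp _ _ _ _ ⊥ ⊥ _ g continuous_bot
        (WeilGroup.continuous_mk (ringOfIntegers F E) E Ω)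

end Restriction

/-! ## Langlands parameters for `GL(n)` -/

section Parameters

/-- Langlands parameters of `GL(n)`: continuous homomorphisms from the local Langlands group
`W × SL(2, ℂ)` to `GL(n, ℂ)` that are semisimple on `W` and algebraic on `SL(2, ℂ)`. -/
structure LParameter (W : Type*) [Group W] [TopologicalSpace W] (n : ℕ) where
  toHom : W × SL(2, ℂ) →* GL (Fin n) ℂ
  continuous_toHom : Continuous toHom
  semisimple : ∀ w : W, ∃ (P : GL (Fin n) ℂ) (d : Fin n → ℂ),
    (P * toHom (w, 1) * P⁻¹ : GL (Fin n) ℂ).1 = Matrix.diagonal d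
  algebraic : ∀ i j : Fin n, ∃ p : MvPolynomial (Fin 2 × Fin 2) ℂ, ∀ g : SL(2, ℂ),
    (toHom (1, g)).1 i j = MvPolynomial.eval (fun k => g.1 k.1 k.2) p

/-- Two parameters are equivalent if they are conjugate under `GL(n, ℂ)`. -/
instance LParameter.setoid (W : Type*) [Group W] [TopologicalSpace W] (n : ℕ) :
    Setoid (LParameter W n) where
  r φ φ' := ∃ g : GL (Fin n) ℂ, ∀ x, g * φ.toHom x * g⁻¹ = φ'.toHom x
  iseqv :=
    { refl := fun φ => ⟨1, fun x => by simp⟩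
      symm := by
        rintro φ φ' ⟨g, h⟩
        exact ⟨g⁻¹, fun x => by rw [← h x]; group⟩
      trans := by
        rintro φ φ' φ'' ⟨g, h⟩ ⟨g', h'⟩
        exact ⟨g' * g, fun x => by rw [← h' x, ← h x]; group⟩ }

/-- The set of equivalence classes of Langlands parameters. -/
def LClass (W : Type*) [Group W] [TopologicalSpace W] (n : ℕ) : Type _ :=
  Quotient (LParameter.setoid W n)

variable {W W' : Type*} [Group W] [TopologicalSpace W] [Group W'] [TopologicalSpace W'] {n : ℕ}

/-- Restriction of a parameter along `r × id : W' × SL(2, ℂ) → W × SL(2, ℂ)`. -/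
def LParameter.restrict (r : W' →ₜ* W) (φ : LParameter W n) : LParameter W' n where
  toHom := φ.toHom.comp (r.toMonoidHom.prodMap (MonoidHom.id _))
  continuous_toHom :=
    φ.continuous_toHom.comp (r.continuous_toFun.prodMap continuous_id)
  semisimple w := φ.semisimple (r w)
  algebraic i j := by
    obtain ⟨p, hp⟩ := φ.algebraic i j
    refine ⟨p, fun g => ?_⟩
    rw [← hp g]
    simp

/-- Restriction of equivalence classes of parameters. -/
def LClass.restrict (r : W' →ₜ* W) : LClass W n → LClass W' n :=
  Quotient.map (LParameter.restrict r) (fun _ _ ⟨g, h⟩ => ⟨g, fun _ => h _⟩)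

/-- The invertible diagonal matrix with the given entries. -/
def diagGL (n : ℕ) : (Fin n → Circle) →* GL (Fin n) ℂ where
  toFun z :=
    { val := Matrix.diagonal fun i => (z i : ℂ)
      inv := Matrix.diagonal fun i => ((z i)⁻¹ : Circle)
      val_inv := by simp [Matrix.diagonal_mul_diagonal]
      inv_val := by simp [Matrix.diagonal_mul_diagonal] }
  map_one' := by
    ext : 1
    simp
  map_mul' x y := by
    ext : 1
    simp [Matrix.diagonal_mul_diagonal]

theorem continuous_diagGL (n : ℕ) : Continuous (diagGL n) := by
  refine Units.continuous_iff.2 ⟨?_, ?_⟩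
  · exact Continuous.matrix_diagonal (by fun_prop)
  · exact Continuous.matrix_diagonal (by fun_prop)

/-- The parameter `(χ₁ ⊗ 1) ⊕ ⋯ ⊕ (χₙ ⊗ 1)`, for unitary characters `χᵢ` of `W`, where `1` is the
trivial representation of `SL(2, ℂ)`. -/
def LParameter.ofCharacters (χ : Fin n → (W →ₜ* Circle)) : LParameter W n where
  toHom := (diagGL n).comp
    ((MonoidHom.pi fun i => (χ i).toMonoidHom).comp (MonoidHom.fst W SL(2, ℂ)))
  continuous_toHom := (continuous_diagGL n).comp
    (continuous_pi fun i => (χ i).continuous_toFun.comp continuous_fst)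
  semisimple w := ⟨1, fun i => (χ i w : ℂ), by
    simp only [one_mul, inv_one, mul_one]
    rfl⟩
  algebraic i j := ⟨MvPolynomial.C ((1 : Matrix (Fin n) (Fin n) ℂ) i j), fun g => by simp⟩

end Parameters

/-! ## Compact orbits and base change -/

section Orbits

variable (O K Ω : Type*) [CommRing O] [Field K] [Field Ω] [Algebra O K] [Algebra K Ω] [Algebra O Ω]
  [IsScalarTower O K Ω]

/-- The group `Ψᵗ(W_K)` of unramified unitary characters of the Weil group (with the compact-open
topology): the characters that are trivial on the inertia group. -/
def unramifiedCharacters : Subgroup (WeilGroup O K Ω →ₜ* Circle) where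
  carrier := {ψ | ∀ w ∈ inertia O K Ω, ψ w = 1}
  one_mem' := fun _ _ => rfl
  mul_mem' := by
    intro ψ ψ' h h' w hw
    change ψ w * ψ' w = 1
    rw [h w hw, h' w hw, mul_one]
  inv_mem' := by
    intro ψ h w hw
    change (ψ w)⁻¹ = 1
    rw [h w hw, inv_one]

/-- The class of the parameter `(ψ₁ ⊗ ρ) ⊕ ⋯ ⊕ (ψₙ ⊗ ρ)`, trivial on `SL(2, ℂ)`. -/
def twistClass (n : ℕ) (ρ : WeilGroup O K Ω →ₜ* Circle)
    (ψ : Fin n → unramifiedCharacters O K Ω) : LClass (WeilGroup O K Ω) n :=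
  Quotient.mk _ (LParameter.ofCharacters fun i => (ψ i : WeilGroup O K Ω →ₜ* Circle) * ρ)

/-- The compact orbit of the parameter `ρ ⊕ ⋯ ⊕ ρ`: the set of classes of the parameters
`(ψ₁ ⊗ ρ) ⊕ ⋯ ⊕ (ψₙ ⊗ ρ)` with unramified unitary characters `ψᵢ`. -/
def CompactOrbit (n : ℕ) (ρ : WeilGroup O K Ω →ₜ* Circle) : Type _ :=
  Set.range (twistClass O K Ω n ρ)

/-- The point of the compact orbit with the given twists. -/
def CompactOrbit.mk (n : ℕ) (ρ : WeilGroup O K Ω →ₜ* Circle)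
    (ψ : Fin n → unramifiedCharacters O K Ω) : CompactOrbit O K Ω n ρ :=
  ⟨twistClass O K Ω n ρ ψ, ψ, rfl⟩

/-- The quotient topology from the space of `n`-tuples of unramified unitary characters. -/
instance (n : ℕ) (ρ : WeilGroup O K Ω →ₜ* Circle) : TopologicalSpace (CompactOrbit O K Ω n ρ) :=
  TopologicalSpace.coinduced (CompactOrbit.mk O K Ω n ρ) inferInstance

end Orbits

section BaseChange

variable (F E Ω : Type*) [Field F] [ValuativeRel F] [TopologicalSpace F]
  [IsNonarchimedeanLocalField F] [Field E] [Algebra F E] [FiniteDimensional F E]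
  [Algebra.IsSeparable F E] [Field Ω] [Algebra F Ω] [Algebra E Ω] [IsScalarTower F E Ω]

/-- Restriction of unramified unitary characters from `W_F` to `W_E`. -/
def restrictUnramified (ψ : unramifiedCharacters 𝒪[F] F Ω) :
    unramifiedCharacters (ringOfIntegers F E) E Ω :=
  ⟨ψ.1.comp (weilInclusion F E Ω),
    fun _ hw => ψ.2 _ (weilInclusionHom_mem_inertia F E Ω hw)⟩

theorem continuous_restrictUnramified : Continuous (restrictUnramified F E Ω) :=
  Continuous.subtype_mk
    ((ContinuousMonoidHom.continuous_comp_left (weilInclusion F E Ω)).comp continuous_subtype_val) _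

theorem restrict_twistClass (n : ℕ) (ρ : WeilGroup 𝒪[F] F Ω →ₜ* Circle)
    (ψ : Fin n → unramifiedCharacters 𝒪[F] F Ω) :
    LClass.restrict (weilInclusion F E Ω) (twistClass 𝒪[F] F Ω n ρ ψ) =
      twistClass (ringOfIntegers F E) E Ω n (ρ.comp (weilInclusion F E Ω))
        (fun i => restrictUnramified F E Ω (ψ i)) := rfl

/-- Base change `E/F`, that is, restriction of Langlands parameters from `W_F × SL(2, ℂ)` to
`W_E × SL(2, ℂ)`, as a continuous map from the compact orbit of `φ = ρ ⊕ ⋯ ⊕ ρ` to the compact orbit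
of the base change of `φ`. -/
def baseChange (n : ℕ) (ρ : WeilGroup 𝒪[F] F Ω →ₜ* Circle) :
    C(CompactOrbit 𝒪[F] F Ω n ρ,
      CompactOrbit (ringOfIntegers F E) E Ω n (ρ.comp (weilInclusion F E Ω))) where
  toFun c := ⟨LClass.restrict (weilInclusion F E Ω) c.1, by
    obtain ⟨_, ψ, rfl⟩ := c
    exact ⟨_, (restrict_twistClass F E Ω n ρ ψ).symm⟩⟩
  continuous_toFun := by
    refine continuous_coinduced_dom.2 ?_
    have h : Continuous (CompactOrbit.mk (ringOfIntegers F E) E Ω n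
        (ρ.comp (weilInclusion F E Ω))) := continuous_coinduced_rng
    have h' : Continuous fun (ψ : Fin n → unramifiedCharacters 𝒪[F] F Ω) i =>
        restrictUnramified F E Ω (ψ i) := continuous_pi fun i =>
      (continuous_restrictUnramified F E Ω).comp (continuous_apply i)
    refine (h.comp h').congr fun ψ => Subtype.ext ?_
    exact (restrict_twistClass F E Ω n ρ ψ).symm

end BaseChange

/-! ## Symmetric products of the circle -/

section Sym

/-- The action of the symmetric group on the torus `𝕋ⁿ`, as an equivalence relation. -/
def symSetoid (n : ℕ) : Setoid (Fin n → Circle) where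
  r x y := ∃ σ : Equiv.Perm (Fin n), ∀ i, y i = x (σ i)
  iseqv :=
    { refl := fun x => ⟨1, fun _ => rfl⟩
      symm := by
        rintro x y ⟨σ, h⟩
        exact ⟨σ⁻¹, fun i => by rw [h]; simp⟩
      trans := by
        rintro x y z ⟨σ, h⟩ ⟨τ, h'⟩
        exact ⟨σ * τ, fun i => by rw [h', h]; rfl⟩ }

/-- The symmetric product `Symⁿ(𝕋) = 𝕋ⁿ / Sₙ` with the quotient topology. -/
abbrev SymCircle (n : ℕ) : Type := Quotient (symSetoid n)

/-- The class `[z₁, …, zₙ]`. -/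
def SymCircle.mk {n : ℕ} (z : Fin n → Circle) : SymCircle n := Quotient.mk (symSetoid n) z

/-- The map `[z₁, …, zₙ] ↦ [z₁ᶠ, …, zₙᶠ]`. -/
def symPow (n f : ℕ) : C(SymCircle n, SymCircle n) where
  toFun := Quotient.map (fun z i => z i ^ f) (by
    rintro x y ⟨σ, h⟩
    exact ⟨σ, fun i => congrArg (· ^ f) (h i)⟩)
  continuous_toFun := Continuous.quotient_map' (by fun_prop) _

/-- The product map `[z₁, …, zₙ] ↦ z₁ ⋯ zₙ`. -/
def symProd (n : ℕ) : C(SymCircle n, Circle) where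
  toFun := Quotient.lift (fun z => ∏ i, z i) (by
    rintro x y ⟨σ, h⟩
    simp only [h]
    exact (Equiv.prod_comp σ x).symm)
  continuous_toFun := Continuous.quotient_lift (by fun_prop) _

/-- For a space `Y` identified with `Symⁿ(𝕋)` by `θ`, the product of the coordinates, as a map from
`Y` to the circle. -/
def prodCoord {Y : Type*} [TopologicalSpace Y] {n : ℕ} (θ : Y ≃ₜ SymCircle n) : C(Y, Circle) where
  toFun y := symProd n (θ y)
  continuous_toFun := (symProd n).continuous.comp θ.continuous

end Sym

end BaseChangeK

end

open BaseChangeK ValuativeRel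

noncomputable section

set_option linter.unusedSectionVars false

namespace BaseChangeK

/-! ## Geometric Frobenius elements and unramified characters -/

/-! An unramified character is determined by its value at a geometric Frobenius element, and every
point of the circle occurs as a value. Indeed the Weil group modulo inertia is `ℤ`, generated by
Frobenius: existence of Frobenius is the surjectivity of a decomposition group onto residue
automorphisms (`exists_isGeomFrob`), and roots of unity of order prime to the residue characteristic
show that its powers act differently (`eq_of_actsAsFrob_one`). Hence `evalFrob` identifies
unramified unitary characters with the circle. Two sums of twists of `ρ` are conjugate exactly when
their values at Frobenius agree up to order (`twistClass_eq_iff`), so each orbit is the symmetric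
product. Since `Φ_E` acts on residues as the `f`-th power of `Φ_F`, up to inertia, restriction
raises the coordinates to the power `f`.

The symmetric product retracts up to homotopy to the circle. A point of it is a periodic increasing
sequence of reals, unique up to a shift of the index (`IsLift.exists_shift`). Moving this sequence
linearly to the equally spaced one with the same sum over a period commutes with shifts, hence
descends. The end result depends only on the sum modulo `ℤ`, that is, on the product of the
coordinates.

For `K¹` of the circle, a perturbation makes a diagonal entry nowhere zero, and Gaussian elimination
then splits it off; by induction everything reduces to nonvanishing functions, which are classified
by winding number (`KOne.mk_mem_zmultiples`). The determinant of a null-homotopy shows that the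
generator has infinite order (`kOneGen_zsmul_eq_zero`). For `K⁰`, a bundle on the circle becomes
constant on the interval, and its gluing automorphism is joined to the identity, so it is trivial
(`exists_vClass_circle_eq`); the trace detects the rank.

Finally, the product of coordinates turns base change into `z ↦ z ^ f` on the circle. This pulls the
generator of `K¹` back to `f` times itself and fixes the trivial bundle. -/

/-- As `O` is integrally closed, integrality means that the minimal polynomial has coefficients in
`O`, the unit ball; the spectral norm is at most 1 under the same condition. -/
theorem isIntegral_iff_spectralNorm_le_one {K L : Type*} [NontriviallyNormedField K] [IsUltrametricDist K]
    [Field L] [Algebra K L] [Algebra.IsAlgebraic K L] (O : Subring K) (hO : ∀ x, x ∈ O ↔ ‖x‖ ≤ 1)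
    [IsIntegrallyClosed O] [IsFractionRing O K]
    (x : L) : IsIntegral O x ↔ spectralNorm K L x ≤ 1 := by
  have hx : IsIntegral K x := Algebra.IsIntegral.isIntegral x
  rw [spectralNorm, spectralValue_le_one_iff (minpoly.monic hx)]
  constructor
  · intro h n
    rw [minpoly.isIntegrallyClosed_eq_field_fractions' K h, Polynomial.coeff_map]
    exact (hO _).1 (Subtype.mem _)
  · intro h
    refine ⟨(minpoly K x).toSubring O ?_, ?_, ?_⟩
    · intro a ha
      obtain ⟨n, -, rfl⟩ := Polynomial.mem_coeffs_iff.1 ha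
      exact (hO _).2 (h n)
    · exact (Polynomial.monic_toSubring _ _ _).2 (minpoly.monic hx)
    · rw [IsScalarTower.algebraMap_eq O K L, ← Polynomial.eval₂_map]
      have : ((minpoly K x).toSubring O (by
          intro a ha
          obtain ⟨n, -, rfl⟩ := Polynomial.mem_coeffs_iff.1 ha
          exact (hO _).2 (h n))).map (algebraMap O K) = minpoly K x :=
        Polynomial.map_toSubring _ _ _
      rw [this]
      exact minpoly.aeval K x

/-- Completeness makes the spectral norm multiplicative, so integral elements of norm 1 are units.
By the ultrametric inequality, `x` and `1 - x` cannot both have norm less than 1. -/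
theorem isLocalRing_integralClosure_of_complete {K L : Type*} [NontriviallyNormedField K]
    [IsUltrametricDist K] [CompleteSpace K]
    [Field L] [Algebra K L] [Algebra.IsAlgebraic K L] (O : Subring K) (hO : ∀ x, x ∈ O ↔ ‖x‖ ≤ 1)
    [IsIntegrallyClosed O] [IsFractionRing O K] : IsLocalRing (integralClosure O L) := by
  have key : ∀ x : integralClosure O L, spectralNorm K L x.1 = 1 → IsUnit x := by
    intro x hx
    have h0 : x.1 ≠ 0 := by
      intro h
      rw [h, spectralNorm_zero] at hx
      exact zero_ne_one hx
    have h1 : spectralNorm K L (x.1⁻¹) = 1 := by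
      have := map_mul (spectralMulAlgNorm K L) x.1 x.1⁻¹
      rw [mul_inv_cancel₀ h0] at this
      simp only [spectralMulAlgNorm_def, hx, one_mul, spectralNorm_one] at this
      exact this.symm
    refine IsUnit.of_mul_eq_one
      ⟨x.1⁻¹, (isIntegral_iff_spectralNorm_le_one O hO _).2 h1.le⟩ (Subtype.ext ?_)
    exact mul_inv_cancel₀ h0
  refine IsLocalRing.of_isUnit_or_isUnit_one_sub_self fun x => ?_
  rw [or_iff_not_imp_left]
  intro hx
  have hx1 : spectralNorm K L x.1 < 1 :=
    lt_of_le_of_ne ((isIntegral_iff_spectralNorm_le_one O hO _).1 x.2) fun h => hx (key x h)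
  refine key _ (le_antisymm ((isIntegral_iff_spectralNorm_le_one O hO _).1 (1 - x).2) ?_)
  have := isNonarchimedean_spectralNorm (K := K) (L := L) (1 - x.1) x.1
  rw [sub_add_cancel, spectralNorm_one, le_max_iff] at this
  exact this.resolve_right (not_le.2 hx1)

theorem isLocalRing_integralClosure (F L : Type*) [Field F] [ValuativeRel F] [TopologicalSpace F]
    [IsNonarchimedeanLocalField F] [Field L] [Algebra F L] [Algebra.IsAlgebraic F L] :
    IsLocalRing (integralClosure 𝒪[F] L) := by
  let := IsTopologicalAddGroup.rightUniformSpace F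
  have := isUniformAddGroup_of_addCommGroup (G := F)
  -- A rank one embedding of the value group turns the valuation into a norm with unit ball `𝒪[F]`.
  let : (Valued.v (R := F) (Γ₀ := ValueGroupWithZero F)).RankOne :=
  { hom' := (IsRankLeOne.nonempty.some.emb (R := F)).comp MonoidWithZeroHom.ValueGroup₀.embedding
    strictMono' := IsRankLeOne.nonempty.some.strictMono.comp
        MonoidWithZeroHom.ValueGroup₀.embedding_strictMono }
  have : CompleteSpace F := inferInstance
  let := Valued.toNontriviallyNormedField (L := F) (Γ₀ := ValueGroupWithZero F)
  refine isLocalRing_integralClosure_of_complete (K := F) 𝒪[F] ?_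
  intro x
  rw [Valued.toNormedField.norm_le_one_iff]
  rfl


theorem isMaximal_jacobson (R : Type*) [CommRing R] [IsLocalRing R] :
    (Ring.jacobson R).IsMaximal := by
  rw [IsLocalRing.ringJacobson_eq_maximalIdeal]
  infer_instance

section Frobenius

variable (O K Ω : Type*) [CommRing O] [Field K] [Field Ω] [Algebra O K] [Algebra K Ω] [Algebra O Ω]
  [IsScalarTower O K Ω]

theorem mem_maxIdealSet_integers {x : Ω} : x ∈ maxIdealSet (integers O Ω) ↔
    ∃ h : x ∈ integralClosure O Ω, (⟨x, h⟩ : integralClosure O Ω) ∈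
      Ring.jacobson (integralClosure O Ω) := by
  constructor
  · rintro ⟨y, hy, rfl⟩
    exact ⟨y.2, hy⟩
  · rintro ⟨h, hy⟩
    exact ⟨⟨x, h⟩, hy, rfl⟩

variable [IsLocalRing O] [IsLocalRing (integralClosure O Ω)]

theorem jacobson_liesOver :
    (Ring.jacobson (integralClosure O Ω)).LiesOver (Ring.jacobson O) := by
  rw [IsLocalRing.ringJacobson_eq_maximalIdeal, IsLocalRing.ringJacobson_eq_maximalIdeal]
  refine ⟨?_⟩
  have : ((IsLocalRing.maximalIdeal (integralClosure O Ω)).comap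
      (algebraMap O (integralClosure O Ω))).IsMaximal :=
    Ideal.isMaximal_comap_of_isIntegral_of_isMaximal _
  exact (IsLocalRing.eq_maximalIdeal this).symm

variable [IsIntegrallyClosed O] [IsFractionRing O K] [IsGalois K Ω]

/-- Fixed elements lie in `K` by infinite Galois theory, and being integral they lie in `O`. -/
theorem isInvariant_integralClosure :
    Algebra.IsInvariant O (integralClosure O Ω) Gal(Ω/K) := by
  refine ⟨fun b hb => ?_⟩
  have h1 : (b : Ω) ∈ Set.range (algebraMap K Ω) := by
    rw [InfiniteGalois.mem_range_algebraMap_iff_fixed]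
    intro f
    exact congrArg Subtype.val (hb f)
  obtain ⟨k, hk⟩ := h1
  have h2 : IsIntegral O k := by
    rw [← isIntegral_algebraMap_iff (FaithfulSMul.algebraMap_injective K Ω), hk]
    exact b.2
  obtain ⟨a, rfl⟩ := IsIntegrallyClosed.algebraMap_eq_of_integral h2
  refine ⟨a, Subtype.ext ?_⟩
  rw [← hk, ← IsScalarTower.algebraMap_apply]
  rfl

open scoped Pointwise in
-- The stabilizer of the maximal ideal maps onto the automorphisms of the residue extension. A
-- preimage of the `q`-power map is an arithmetic Frobenius; its inverse is geometric.
theorem exists_isGeomFrob [Finite (Residue O)] : ∃ Φ, IsGeomFrob O K Ω Φ := by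
  let B := integralClosure O Ω
  let P := Ring.jacobson O
  let Q := Ring.jacobson B
  have hP : P.IsMaximal := isMaximal_jacobson O
  have hQ : Q.IsMaximal := isMaximal_jacobson B
  have hPQ : Q.LiesOver P := jacobson_liesOver O Ω
  -- The surjectivity result for profinite groups needs a continuous action on a discrete ring;
  -- stabilizers are open because integral elements are algebraic.
  let _ : TopologicalSpace B := ⊥
  have : DiscreteTopology B := ⟨rfl⟩
  have : ContinuousSMul Gal(Ω/K) B := by
    rw [continuousSMul_iff_stabilizer_isOpen]
    intro x
    convert! stabilizer_isOpen_of_isIntegral (K := K) (x : Ω)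
    ext g
    exact Subtype.ext_iff
  have := isInvariant_integralClosure O K Ω
  let : Field (O ⧸ P) := Ideal.Quotient.field P
  let : Field (B ⧸ Q) := Ideal.Quotient.field Q
  have : Fintype (O ⧸ P) := Fintype.ofFinite _
  have : Algebra.IsIntegral (O ⧸ P) (B ⧸ Q) := inferInstance
  obtain ⟨σ, hσ⟩ := Ideal.Quotient.stabilizerHom_surjective_of_profinite (G := Gal(Ω/K)) P Q
    (FiniteField.frobeniusAlgEquivOfAlgebraic (O ⧸ P) (B ⧸ Q))
  have h1 : ActsAsFrob O K Ω σ.1 0 1 := by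
    intro x hx
    rw [mem_maxIdealSet_integers]
    have h2 := DFunLike.congr_fun hσ (Ideal.Quotient.mk Q ⟨x, hx⟩)
    rw [Ideal.Quotient.stabilizerHom_apply, FiniteField.coe_frobeniusAlgEquivOfAlgebraic] at h2
    have h3 : Ideal.Quotient.mk Q (σ.1 • (⟨x, hx⟩ : B)) =
        Ideal.Quotient.mk Q (⟨x, hx⟩ ^ Fintype.card (O ⧸ P)) := h2
    rw [Ideal.Quotient.eq, ← Nat.card_eq_fintype_card] at h3
    rw [pow_zero, pow_one, pow_one]
    exact ⟨_, h3⟩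
  refine ⟨⟨σ.1⁻¹, 1, 0, h1.inv⟩, h1.inv⟩

end Frobenius

/-! ### Uniqueness of the Frobenius exponent of an automorphism. -/

section Order

variable {O K Ω : Type*} [CommRing O] [Field K] [Field Ω] [Algebra O K] [Algebra K Ω] [Algebra O Ω]
  [IsScalarTower O K Ω] [IsLocalRing O] [IsLocalRing (integralClosure O Ω)] [Finite (Residue O)]

/-- The cardinality `q` vanishes in the residue field, so `q ^ m` lies in the maximal ideal. -/
theorem isUnit_residueCard_pow_sub_one (m : ℕ) (hm : m ≠ 0) :
    IsUnit ((residueCard O : O) ^ m - 1) := by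
  have h1 : (residueCard O : O) ∈ Ring.jacobson O := by
    rw [← Ideal.Quotient.eq_zero_iff_mem, map_natCast]
    have : Fintype (Residue O) := Fintype.ofFinite _
    rw [residueCard, Nat.card_eq_fintype_card]
    exact Nat.cast_card_eq_zero (Residue O)
  rw [IsLocalRing.ringJacobson_eq_maximalIdeal] at h1
  have h2 : (residueCard O : O) ^ m ∈ IsLocalRing.maximalIdeal O := Ideal.pow_mem_of_mem _ h1 _
    (Nat.pos_of_ne_zero hm)
  by_contra h
  have h3 : (residueCard O : O) ^ m - 1 ∈ IsLocalRing.maximalIdeal O := h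
  exact (Ideal.ne_top_iff_one _).1 (IsLocalRing.maximalIdeal.isMaximal O).ne_top
    (by simpa using sub_mem h2 h3)

theorem one_lt_residueCard : 1 < residueCard O := by
  have := (isMaximal_jacobson O).ne_top
  have : Nontrivial (Residue O) := Ideal.Quotient.nontrivial_iff.2 this
  exact Finite.one_lt_card

/-- A primitive root of unity whose order `N` is a unit cannot have a nontrivial power congruent to
1: the geometric sum of that power over `N` terms is zero, yet would be congruent to `N`. -/
theorem not_actsAsFrob_one_of_lt [IsSepClosed Ω] {a b : ℕ} (hab : a < b)
    (h : ActsAsFrob O K Ω 1 a b) : False := by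
  set q := residueCard O with hq
  have hq1 : 1 < q := one_lt_residueCard
  let B := integralClosure O Ω
  let Q := Ring.jacobson B
  have hQ : Q.IsMaximal := isMaximal_jacobson B
  -- This order is a unit in `O` and exceeds `q ^ b`, hence also the positive difference `q ^ b - q
  -- ^ a`, which is `k + 1` below.
  set N := q ^ (b + 1) - 1 with hN
  have hN1 : q ^ b < N := by
    have := Nat.mul_le_mul_left (q ^ b) hq1
    have := Nat.one_lt_pow (n := b) (by omega) hq1
    rw [hN, pow_succ]
    omega
  have hcast : ((q : O) ^ (b + 1) - 1) = (N : O) := by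
    rw [hN, Nat.cast_sub (Nat.one_le_pow _ _ (by omega))]
    push_cast
    rfl
  have hu : IsUnit (N : O) := by
    rw [← hcast]
    exact isUnit_residueCard_pow_sub_one _ (by omega)
  have huB : IsUnit (N : B) := by
    have := hu.map (algebraMap O B)
    rwa [map_natCast] at this
  have huΩ : NeZero (N : Ω) := by
    have := hu.map (algebraMap O Ω)
    rw [map_natCast] at this
    exact ⟨this.ne_zero⟩
  obtain ⟨ζ, hζ⟩ := HasEnoughRootsOfUnity.exists_primitiveRoot Ω N
  have hζO : ζ ∈ B := by
    refine ⟨Polynomial.X ^ N - 1, Polynomial.monic_X_pow_sub_C _ (by omega), ?_⟩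
    simp [hζ.pow_eq_one]
  let z : B := ⟨ζ, hζO⟩
  have hzN : z ^ N = 1 := Subtype.ext hζ.pow_eq_one
  obtain ⟨_, h1⟩ := (mem_maxIdealSet_integers O Ω).1 (h ζ hζO)
  have h2 : z ^ q ^ a - z ^ q ^ b ∈ Q := h1
  obtain ⟨k, hk⟩ := Nat.exists_eq_add_of_lt (Nat.pow_lt_pow_right hq1 hab)
  have hzu : IsUnit z := IsUnit.of_pow_eq_one hzN (by omega)
  have h3 : (1 - z ^ (k + 1)) ∈ Q := by
    rw [hk, add_assoc, pow_add, ← mul_one_sub] at h2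
    exact (hQ.isPrime.mem_or_mem h2).resolve_left fun h =>
      hQ.ne_top (Ideal.eq_top_of_isUnit_mem _ h (hzu.pow _))
  have h4 : ∑ i ∈ Finset.range N, (z ^ (k + 1)) ^ i = 0 := by
    have h5 : z ^ (k + 1) - 1 ≠ 0 := by
      intro h5
      have h6 : ζ ^ (k + 1) = 1 := congrArg Subtype.val (sub_eq_zero.1 h5)
      have := Nat.le_of_dvd (by omega) (hζ.dvd_of_pow_eq_one _ h6)
      omega
    have h6 : (z ^ (k + 1)) ^ N = 1 := by rw [← pow_mul, mul_comm, pow_mul, hzN, one_pow]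
    have := geom_sum_mul (z ^ (k + 1)) N
    rw [h6, sub_self] at this
    exact (mul_eq_zero.1 this).resolve_right h5
  have h5 : (N : B) ∈ Q := by
    rw [← Ideal.Quotient.eq_zero_iff_mem]
    have := congrArg (Ideal.Quotient.mk Q) h4
    rw [← Ideal.Quotient.eq_zero_iff_mem, map_sub, map_one, sub_eq_zero] at h3
    simpa [← h3] using this
  exact hQ.ne_top (Ideal.eq_top_of_isUnit_mem _ h5 huB)

theorem eq_of_actsAsFrob_one [IsSepClosed Ω] {a b : ℕ} (h : ActsAsFrob O K Ω 1 a b) : a = b := by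
  rcases lt_trichotomy a b with hab | hab | hab
  · exact (not_actsAsFrob_one_of_lt hab h).elim
  · exact hab
  · exact (not_actsAsFrob_one_of_lt hab (by simpa using h.inv)).elim

/-- The `q`-power map is injective on the residue field of `Ω`. This lets an element of degree 0,
known only through exponents `a, a`, be recognised as inertial. -/
theorem ActsAsFrob.cancel {σ : Gal(Ω/K)} {a b : ℕ} (n : ℕ)
    (h : ActsAsFrob O K Ω σ (a + n) (b + n)) : ActsAsFrob O K Ω σ a b := by
  let B := integralClosure O Ω
  let P := Ring.jacobson O
  let Q := Ring.jacobson B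
  have hP : P.IsMaximal := isMaximal_jacobson O
  have hQ : Q.IsMaximal := isMaximal_jacobson B
  have hPQ : Q.LiesOver P := jacobson_liesOver O Ω
  let : Field (O ⧸ P) := Ideal.Quotient.field P
  let : Field (B ⧸ Q) := Ideal.Quotient.field Q
  have : Fintype (O ⧸ P) := Fintype.ofFinite _
  have hinj : Function.Injective fun x : B ⧸ Q => x ^ residueCard O ^ n := by
    clear h
    induction n with
    | zero =>
      intro x y hxy
      simpa using hxy
    | succ n ih =>
      have h1 : Function.Injective fun x : B ⧸ Q => x ^ residueCard O := by
        have : Function.Injective fun x : B ⧸ Q => x ^ Fintype.card (O ⧸ P) :=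
          (FiniteField.frobeniusAlgHom (O ⧸ P) (B ⧸ Q)).toRingHom.injective
        rwa [← Nat.card_eq_fintype_card] at this
      simp only [pow_succ, pow_mul]
      exact h1.comp ih
  intro x hx
  have h1 := h x hx
  rw [pow_add, pow_add, pow_mul, pow_mul] at h1
  rw [mem_maxIdealSet_integers] at h1 ⊢
  obtain ⟨h1, h2⟩ := h1
  let y : B := ⟨σ x, map_mem_integers O K Ω σ hx⟩
  have h3 : (y ^ residueCard O ^ a) ^ residueCard O ^ n -
    ((⟨x, hx⟩ : B) ^ residueCard O ^ b) ^ residueCard O ^ n ∈ Q := h2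
  rw [← Ideal.Quotient.eq, map_pow, map_pow _ _ (residueCard O ^ n)] at h3
  exact ⟨_, (Ideal.Quotient.eq).1 (hinj h3)⟩

end Order

/-! ### Frobenius elements for a local field and its finite extension. -/

section LocalField

variable (F E Ω : Type*) [Field F] [ValuativeRel F] [TopologicalSpace F]
  [IsNonarchimedeanLocalField F] [Field E] [Algebra F E] [FiniteDimensional F E]
  [Algebra.IsSeparable F E] [Field Ω] [Algebra F Ω] [Algebra E Ω] [IsScalarTower F E Ω]

theorem finite_residue : Finite (Residue 𝒪[F]) := by
  have : Finite (IsLocalRing.ResidueField 𝒪[F]) := inferInstance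
  rw [Residue, IsLocalRing.ringJacobson_eq_maximalIdeal]
  exact this

theorem finite_residue_ringOfIntegers : Finite (Residue (ringOfIntegers F E)) := by
  let := (residueMap F E).toAlgebra
  have : Module.Finite 𝒪[F] (ringOfIntegers F E) :=
    IsIntegralClosure.finite 𝒪[F] F E (ringOfIntegers F E)
  have : IsScalarTower 𝒪[F] (Residue 𝒪[F]) (Residue (ringOfIntegers F E)) :=
    IsScalarTower.of_algebraMap_eq fun x => rfl
  have : Module.Finite 𝒪[F] (Residue (ringOfIntegers F E)) :=
    Module.Finite.of_surjective
      (Ideal.Quotient.mkₐ 𝒪[F] (Ring.jacobson (ringOfIntegers F E))).toLinearMap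
      Ideal.Quotient.mk_surjective
  have : Module.Finite (Residue 𝒪[F]) (Residue (ringOfIntegers F E)) :=
    Module.Finite.of_restrictScalars_finite 𝒪[F] _ _
  have := finite_residue F
  exact Module.finite_of_finite (Residue 𝒪[F])

theorem isLocalRing_integralClosure_ringOfIntegers [Algebra.IsAlgebraic F Ω] :
    IsLocalRing (integralClosure (ringOfIntegers F E) Ω) := by
  have : IsLocalRing (integers (ringOfIntegers F E) Ω) := by
    rw [integers_ringOfIntegers]
    exact isLocalRing_integralClosure F Ω
  exact this

theorem exists_isGeomFrob_base [IsSepClosure F Ω] : ∃ Φ, IsGeomFrob 𝒪[F] F Ω Φ := by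
  have : IsGalois F Ω := IsSepClosure.isGalois
  have := finite_residue F
  have := isLocalRing_integralClosure F Ω
  exact exists_isGeomFrob _ _ _

theorem exists_isGeomFrob_extension [IsSepClosure F Ω] :
    ∃ Φ, IsGeomFrob (ringOfIntegers F E) E Ω Φ := by
  have : IsGalois F Ω := IsSepClosure.isGalois
  have : IsGalois E Ω := IsGalois.tower_top_of_isGalois F E Ω
  have := finite_residue_ringOfIntegers F E
  have := isLocalRing_integralClosure F E
  have := isLocalRing_integralClosure_ringOfIntegers F E Ω
  have : IsIntegrallyClosed (ringOfIntegers F E) :=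
    integralClosure.isIntegrallyClosedOfFiniteExtension F
  have : IsFractionRing (ringOfIntegers F E) E :=
    integralClosure.isFractionRing_of_finite_extension F E
  exact exists_isGeomFrob _ _ _

end LocalField

/-! ### The degree map on the Weil group and unramified characters. -/

section Unramified

variable (O K Ω : Type*) [CommRing O] [Field K] [Field Ω] [Algebra O K] [Algebra K Ω] [Algebra O Ω]
  [IsScalarTower O K Ω]

/-- The valuation `W → ℤ` of the Weil group, normalised to be `1` on geometric Frobenius
elements. -/
def weilDegree (w : WeilGroup O K Ω) : ℤ := w.2.choose - w.2.choose_spec.choose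

variable [IsLocalRing O] [IsLocalRing (integralClosure O Ω)] [Finite (Residue O)] [IsSepClosed Ω]

variable {O K Ω}

/-- Independence of the chosen exponents: combining one pair for `w` with another for `w⁻¹` gives a
pair for the identity, whose two exponents must agree. -/
theorem weilDegree_eq {w : WeilGroup O K Ω} {a b : ℕ}
    (h : ActsAsFrob O K Ω (WeilGroup.toGal O K Ω w) a b) : weilDegree O K Ω w = a - b := by
  have h1 : ActsAsFrob O K Ω (WeilGroup.toGal O K Ω w) w.2.choose w.2.choose_spec.choose :=
    w.2.choose_spec.choose_spec
  have h2 := h1.mul h.inv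
  rw [mul_inv_cancel] at h2
  have := eq_of_actsAsFrob_one h2
  rw [weilDegree]
  omega

theorem weilDegree_mul (v w : WeilGroup O K Ω) :
    weilDegree O K Ω (v * w) = weilDegree O K Ω v + weilDegree O K Ω w := by
  obtain ⟨a, b, h⟩ := v.2
  obtain ⟨c, d, h'⟩ := w.2
  rw [weilDegree_eq (w := v) h, weilDegree_eq (w := w) h', weilDegree_eq (w := v * w) (h.mul h')]
  push_cast
  ring

theorem mem_inertia_iff {w : WeilGroup O K Ω} : w ∈ inertia O K Ω ↔ weilDegree O K Ω w = 0 := by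
  constructor
  · intro h
    simpa using weilDegree_eq (a := 0) (b := 0) h
  · intro h
    obtain ⟨a, b, hw⟩ := w.2
    rw [weilDegree_eq (w := w) hw] at h
    obtain rfl : a = b := by omega
    refine ActsAsFrob.cancel a ?_
    rw [zero_add]
    exact hw

/-- The valuation of the Weil group as a homomorphism. -/
def weilDegreeHom : WeilGroup O K Ω →* Multiplicative ℤ :=
  MonoidHom.mk' (fun w => .ofAdd (weilDegree O K Ω w)) fun v w => by
    rw [weilDegree_mul, ofAdd_add]

theorem continuous_weilDegree : Continuous (weilDegree O K Ω) := by
  let g : WeilGroup O K Ω ⧸ inertia O K Ω → ℤ := Quotient.lift (weilDegree O K Ω) (by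
    intro v w h
    have h1 := mem_inertia_iff.1 (QuotientGroup.leftRel_apply.1 h)
    have h2 := weilDegree_mul v (v⁻¹ * w)
    rw [mul_inv_cancel_left] at h2
    omega)
  exact @Continuous.comp _ _ _ _ ⊥ _ _ g continuous_bot (WeilGroup.continuous_mk O K Ω)

theorem weilDegree_geomFrob {Φ : WeilGroup O K Ω} (hΦ : IsGeomFrob O K Ω Φ) :
    weilDegree O K Ω Φ = 1 := by
  simpa using weilDegree_eq (a := 1) (b := 0) hΦ

/-- Dividing `w` by the power of `Φ` of the same degree leaves an element of inertia. -/
theorem unramified_apply {Φ : WeilGroup O K Ω} (hΦ : IsGeomFrob O K Ω Φ)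
    (ψ : unramifiedCharacters O K Ω) (w : WeilGroup O K Ω) :
    ψ.1 w = ψ.1 Φ ^ weilDegree O K Ω w := by
  have h1 : w * (Φ ^ weilDegree O K Ω w)⁻¹ ∈ inertia O K Ω := by
    rw [mem_inertia_iff]
    have h2 := map_mul weilDegreeHom w (Φ ^ weilDegree O K Ω w)⁻¹
    rw [map_inv, map_zpow] at h2
    have h3 := congrArg Multiplicative.toAdd h2
    have h4 : weilDegreeHom Φ = .ofAdd 1 := congrArg Multiplicative.ofAdd (weilDegree_geomFrob hΦ)
    rw [h4] at h3
    change weilDegree O K Ω _ = weilDegree O K Ω w + -(weilDegree O K Ω w * 1) at h3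
    rw [h3]
    ring
  have h2 := ψ.2 _ h1
  rwa [map_mul, map_inv, map_zpow, mul_inv_eq_one] at h2

/-- The unramified unitary character with value `z` on geometric Frobenius elements. -/
def unramifiedOf (z : Circle) : unramifiedCharacters O K Ω :=
  ⟨{ toMonoidHom := MonoidHom.mk' (fun w => z ^ weilDegree O K Ω w) fun v w => by
      rw [weilDegree_mul, zpow_add]
     continuous_toFun := (continuous_of_discreteTopology (f := fun n : ℤ => z ^ n)).comp
      continuous_weilDegree }, fun w hw => by
      change z ^ weilDegree O K Ω w = 1
      rw [mem_inertia_iff.1 hw, zpow_zero]⟩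

theorem unramifiedOf_apply (z : Circle) (w : WeilGroup O K Ω) :
    (unramifiedOf z : unramifiedCharacters O K Ω).1 w = z ^ weilDegree O K Ω w := rfl

/-- For the compact-open topology it suffices that the uncurried map is continuous; it factors
through `(z, k) ↦ z ^ k` with `k` in the discrete space `ℤ`. -/
theorem continuous_unramifiedOf :
    Continuous (unramifiedOf : Circle → unramifiedCharacters O K Ω) := by
  refine Continuous.subtype_mk ?_ _
  rw [ContinuousMonoidHom.isInducing_toContinuousMap _ _ |>.continuous_iff]
  refine ContinuousMap.continuous_of_continuous_uncurry _ ?_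
  have h1 : Continuous fun p : Circle × ℤ => p.1 ^ p.2 :=
    continuous_prod_of_discrete_right.2 fun n => continuous_zpow n
  exact h1.comp (continuous_id.prodMap continuous_weilDegree)

/-- Evaluation at a geometric Frobenius element identifies the group of unramified unitary
characters with the circle. -/
def evalFrob {Φ : WeilGroup O K Ω} (hΦ : IsGeomFrob O K Ω Φ) :
    unramifiedCharacters O K Ω ≃ₜ Circle where
  toFun ψ := ψ.1 Φ
  invFun := unramifiedOf
  left_inv ψ := by
    refine Subtype.ext (ContinuousMonoidHom.ext fun w => ?_)
    rw [unramifiedOf_apply, unramified_apply hΦ ψ w]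
  right_inv z := by
    change (unramifiedOf z : unramifiedCharacters O K Ω).1 Φ = z
    rw [unramifiedOf_apply, weilDegree_geomFrob hΦ, zpow_one]
  continuous_toFun :=
    (continuous_eval_const (F := C(WeilGroup O K Ω, Circle)) Φ).comp
      ((ContinuousMonoidHom.isInducing_toContinuousMap _ _).continuous.comp continuous_subtype_val)
  continuous_invFun := continuous_unramifiedOf

end Unramified

/-! ## The coordinates of a compact orbit -/

/-- Corresponding fibres have equal cardinality, and bijections between them glue to a permutation.
-/
theorem exists_perm_of_multiset_map_eq {n : ℕ} {α : Type*} (x y : Fin n → α)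
    (h : Finset.univ.val.map x = Finset.univ.val.map y) :
    ∃ σ : Equiv.Perm (Fin n), ∀ i, y i = x (σ i) := by
  classical
  have h1 : ∀ a, Nonempty ({i // y i = a} ≃ {i // x i = a}) := by
    intro a
    rw [← Fintype.card_eq, Fintype.card_subtype, Fintype.card_subtype]
    have h2 := congrArg (Multiset.count a) h
    rw [Multiset.count_map, Multiset.count_map] at h2
    simp only [eq_comm (a := a)] at h2
    exact h2.symm
  exact ⟨Equiv.ofFiberEquiv fun a => (h1 a).some,
    fun i => (Equiv.ofFiberEquiv_map (fun a => (h1 a).some) i).symm⟩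

/-- The permutation matrix of `σ`. -/
def permGL {n : ℕ} (σ : Equiv.Perm (Fin n)) : GL (Fin n) ℂ where
  val := (1 : Matrix (Fin n) (Fin n) ℂ).submatrix σ id
  inv := (1 : Matrix (Fin n) (Fin n) ℂ).submatrix id σ
  val_inv := by
    have := Matrix.submatrix_mul_equiv (1 : Matrix (Fin n) (Fin n) ℂ) 1 σ (Equiv.refl _) σ
    simpa using this
  inv_val := by
    simp

theorem permGL_conj {n : ℕ} (σ : Equiv.Perm (Fin n)) (A : Matrix (Fin n) (Fin n) ℂ) :
    (permGL σ).1 * A * (permGL σ)⁻¹.1 = A.submatrix σ σ := by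
  change (1 : Matrix (Fin n) (Fin n) ℂ).submatrix σ id * A *
    (1 : Matrix (Fin n) (Fin n) ℂ).submatrix id σ = _
  have h1 := Matrix.one_submatrix_mul (e₁ := σ) (e₂ := Equiv.refl _) A
  have h2 := Matrix.mul_submatrix_one (Equiv.refl _) σ (A.submatrix σ id)
  simp only [Equiv.coe_refl, Equiv.refl_symm, Function.id_comp, Matrix.submatrix_submatrix,
    Function.comp_id] at h1 h2
  rw [h1, h2]

theorem permGL_conj_diagGL {n : ℕ} (σ : Equiv.Perm (Fin n)) (z : Fin n → Circle) :
    permGL σ * diagGL n z * (permGL σ)⁻¹ = diagGL n fun i => z (σ i) := by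
  ext : 1
  exact (permGL_conj σ _).trans (Matrix.submatrix_diagonal_equiv _ _)

theorem exists_perm_of_prod_X_sub_C_eq {n : ℕ} (x y : Fin n → ℂ)
    (h : ∏ i, (Polynomial.X - Polynomial.C (x i)) = ∏ i, (Polynomial.X - Polynomial.C (y i))) :
    ∃ σ : Equiv.Perm (Fin n), ∀ i, y i = x (σ i) := by
  have h2 : ∀ w : Fin n → ℂ, (∏ i, (Polynomial.X - Polynomial.C (w i))).roots =
      Finset.univ.val.map w := by
    intro w
    rw [← Polynomial.roots_multiset_prod_X_sub_C (Finset.univ.val.map w), Multiset.map_map,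
      Finset.prod_eq_multiset_prod]
    simp only [Function.comp_def]
  exact exists_perm_of_multiset_map_eq x y (by rw [← h2, ← h2, h])

theorem exists_perm_of_conj_diagonal {n : ℕ} (x y : Fin n → ℂ) (g : GL (Fin n) ℂ)
    (h : g.1 * Matrix.diagonal x * (g⁻¹).1 = Matrix.diagonal y) :
    ∃ σ : Equiv.Perm (Fin n), ∀ i, y i = x (σ i) := by
  have h1 := Matrix.charpoly_units_conj g (Matrix.diagonal x)
  rw [← Matrix.coe_units_inv, h, Matrix.charpoly_diagonal, Matrix.charpoly_diagonal] at h1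
  exact exists_perm_of_prod_X_sub_C_eq x y h1.symm

/-- Two quotient maps with the same fibres have homeomorphic targets. -/
def homeomorphOfQuotientMaps {X Y Z : Type*} [TopologicalSpace X] [TopologicalSpace Y]
    [TopologicalSpace Z] {p : C(X, Y)} {q : C(X, Z)} (hp : Topology.IsQuotientMap p)
    (hq : Topology.IsQuotientMap q) (h : ∀ a b, p a = p b ↔ q a = q b) : Y ≃ₜ Z where
  toFun := hp.lift q fun a b hab => (h a b).1 hab
  invFun := hq.lift p fun a b hab => (h a b).2 hab
  left_inv y := by
    obtain ⟨x, rfl⟩ := hp.surjective y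
    have h1 := DFunLike.congr_fun (hp.lift_comp q fun a b hab => (h a b).1 hab) x
    have h2 := DFunLike.congr_fun (hq.lift_comp p fun a b hab => (h a b).2 hab) x
    simp only [ContinuousMap.comp_apply] at h1 h2
    rw [h1, h2]
  right_inv z := by
    obtain ⟨x, rfl⟩ := hq.surjective z
    have h1 := DFunLike.congr_fun (hp.lift_comp q fun a b hab => (h a b).1 hab) x
    have h2 := DFunLike.congr_fun (hq.lift_comp p fun a b hab => (h a b).2 hab) x
    simp only [ContinuousMap.comp_apply] at h1 h2
    rw [h2, h1]
  continuous_toFun := ContinuousMap.continuous _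
  continuous_invFun := ContinuousMap.continuous _

theorem homeomorphOfQuotientMaps_apply {X Y Z : Type*} [TopologicalSpace X] [TopologicalSpace Y]
    [TopologicalSpace Z] {p : C(X, Y)} {q : C(X, Z)} (hp : Topology.IsQuotientMap p)
    (hq : Topology.IsQuotientMap q) (h : ∀ a b, p a = p b ↔ q a = q b) (x : X) :
    homeomorphOfQuotientMaps hp hq h (p x) = q x :=
  DFunLike.congr_fun (hp.lift_comp q fun a b hab => (h a b).1 hab) x

section Orbit

variable {O K Ω : Type*} [CommRing O] [Field K] [Field Ω] [Algebra O K] [Algebra K Ω] [Algebra O Ω]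
  [IsScalarTower O K Ω] [IsLocalRing O] [IsLocalRing (integralClosure O Ω)] [Finite (Residue O)]
  [IsSepClosed Ω]

/-- Conjugate parameters have the same eigenvalues at `Φ`, and the common factor `ρ Φ` cancels.
Conversely, equal values at `Φ` up to order give equal characters up to order, and a permutation
matrix conjugates the sums. -/
theorem twistClass_eq_iff {n : ℕ} (ρ : WeilGroup O K Ω →ₜ* Circle) {Φ : WeilGroup O K Ω}
    (hΦ : IsGeomFrob O K Ω Φ) (ψ ψ' : Fin n → unramifiedCharacters O K Ω) :
    twistClass O K Ω n ρ ψ = twistClass O K Ω n ρ ψ' ↔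
      SymCircle.mk (fun i => (ψ i).1 Φ) = SymCircle.mk fun i => (ψ' i).1 Φ := by
  constructor
  · intro h
    obtain ⟨g, hg⟩ := Quotient.exact h
    have h1 := congrArg Units.val (hg (Φ, 1))
    obtain ⟨σ, hσ⟩ := exists_perm_of_conj_diagonal
      (fun i => (((ψ i).1 Φ * ρ Φ : Circle) : ℂ)) (fun i => (((ψ' i).1 Φ * ρ Φ : Circle) : ℂ)) g h1
    refine Quotient.sound ⟨σ, fun i => ?_⟩
    exact mul_right_cancel (Circle.ext (hσ i))
  · intro h
    obtain ⟨σ, hσ⟩ := Quotient.exact h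
    have h1 : ψ' = fun i => ψ (σ i) := funext fun i => (evalFrob hΦ).injective (hσ i)
    subst h1
    exact Quotient.sound ⟨permGL σ, fun x => permGL_conj_diagGL σ _⟩

/-- Both spaces are quotients of the space of tuples of unramified characters, with the same fibres.
-/
theorem exists_orbit_homeomorph (n : ℕ) (ρ : WeilGroup O K Ω →ₜ* Circle) {Φ : WeilGroup O K Ω}
    (hΦ : IsGeomFrob O K Ω Φ) : ∃ θ : CompactOrbit O K Ω n ρ ≃ₜ SymCircle n,
      ∀ ψ, θ (CompactOrbit.mk O K Ω n ρ ψ) = SymCircle.mk fun i => (ψ i).1 Φ := by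
  have hp : Topology.IsQuotientMap (CompactOrbit.mk O K Ω n ρ) :=
    { eq_coinduced := rfl
      surjective := fun ⟨_, ψ, h⟩ => ⟨ψ, Subtype.ext h⟩ }
  have hq : Topology.IsQuotientMap fun ψ : Fin n → unramifiedCharacters O K Ω =>
      SymCircle.mk fun i => (ψ i).1 Φ :=
    isQuotientMap_quotient_mk'.comp (Homeomorph.piCongrRight fun _ => evalFrob hΦ).isQuotientMap
  exact ⟨homeomorphOfQuotientMaps (p := ⟨_, hp.continuous⟩) (q := ⟨_, hq.continuous⟩) hp hq
    fun ψ ψ' => Subtype.ext_iff.trans (twistClass_eq_iff ρ hΦ ψ ψ'),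
    fun ψ => homeomorphOfQuotientMaps_apply (p := ⟨_, hp.continuous⟩) (q := ⟨_, hq.continuous⟩)
      hp hq _ ψ⟩

end Orbit

/-- The residue field of `E` has `q ^ f` elements, so `Φ_E` has degree `f` in the Weil group of `F`.
-/
theorem unramified_weilInclusion {F E Ω : Type*} [Field F] [ValuativeRel F] [TopologicalSpace F]
    [IsNonarchimedeanLocalField F] [Field E] [Algebra F E] [FiniteDimensional F E]
    [Algebra.IsSeparable F E] [Field Ω] [Algebra F Ω] [Algebra E Ω] [IsScalarTower F E Ω]
    [Algebra.IsAlgebraic F Ω] [IsSepClosed Ω]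
    {Φ_F : WeilGroup 𝒪[F] F Ω} {Φ_E : WeilGroup (ringOfIntegers F E) E Ω}
    (hF : IsGeomFrob 𝒪[F] F Ω Φ_F) (hE : IsGeomFrob (ringOfIntegers F E) E Ω Φ_E)
    (ψ : unramifiedCharacters 𝒪[F] F Ω) :
    (restrictUnramified F E Ω ψ).1 Φ_E = ψ.1 Φ_F ^ residueDegree F E := by
  have := finite_residue F
  have := isLocalRing_integralClosure F Ω
  have h1 : ActsAsFrob 𝒪[F] F Ω (WeilGroup.toGal 𝒪[F] F Ω (weilInclusion F E Ω Φ_E)) _ _ :=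
    ActsAsFrob.restrict hE
  have h2 := unramified_apply hF ψ (weilInclusion F E Ω Φ_E)
  rw [weilDegree_eq h1, mul_one, mul_zero, Nat.cast_zero, sub_zero, zpow_natCast] at h2
  exact h2

/-! ## The symmetric product of the circle -/

section SymmetricProduct

open Real

theorem exp_two_pi_eq_iff {a b : ℝ} :
    Circle.exp (2 * π * a) = Circle.exp (2 * π * b) ↔ ∃ k : ℤ, a = b + k := by
  rw [Circle.exp_eq_exp]
  refine exists_congr fun k => ⟨fun h => ?_, fun h => by rw [h]; ring⟩
  have : 2 * π * (a - (b + k)) = 0 := by linear_combination h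
  rcases mul_eq_zero.1 this with h | h
  · exact (two_pi_pos.ne' h).elim
  · linarith

theorem exists_exp_two_pi_eq (z : Circle) : ∃ t : ℝ, 0 ≤ t ∧ t < 1 ∧ Circle.exp (2 * π * t) = z := by
  obtain ⟨s, rfl⟩ := Circle.exp_surjective z
  refine ⟨Int.fract (s / (2 * π)), Int.fract_nonneg _, Int.fract_lt_one _, ?_⟩
  have : s = 2 * π * (s / (2 * π)) := by field_simp
  conv_rhs => rw [this]
  exact exp_two_pi_eq_iff.2 ⟨-⌊s / (2 * π)⌋, by rw [Int.fract]; push_cast; ring⟩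

variable {n : ℕ}

/-- Sequences of real numbers which increase by `1` after `n` steps: lifts to `ℝ` of `n`-tuples of
points of the circle. -/
def IsLift (n : ℕ) (x : ℤ → ℝ) : Prop := ∀ i, x (i + n) = x i + 1

theorem IsLift.add_mul {x : ℤ → ℝ} (hx : IsLift n x) (i k : ℤ) : x (i + n * k) = x i + k := by
  induction k with
  | zero => simp
  | succ k ih =>
    have := hx (i + n * k)
    rw [ih] at this
    rw [mul_add, mul_one, ← add_assoc, this]
    push_cast
    ring
  | pred k ih =>
    have := hx (i + n * (-k - 1))
    rw [show i + n * (-k - 1) + n = i + n * (-k : ℤ) by ring, ih] at this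
    push_cast at this ⊢
    linarith

theorem IsLift.eq_emod {x : ℤ → ℝ} (hx : IsLift n x) (i : ℤ) : x i = x (i % n) + (i / n : ℤ) := by
  rw [← hx.add_mul, Int.emod_add_mul_ediv]

theorem IsLift.shift {x : ℤ → ℝ} (hx : IsLift n x) (K : ℤ) : IsLift n fun i => x (i + K) := by
  intro i
  change x (i + n + K) = x (i + K) + 1
  rw [← hx]
  congr 1
  ring

/-- A shift by one step replaces the term `x 0` by `x n = x 0 + 1`. -/
theorem IsLift.sum_shift {x : ℤ → ℝ} (hx : IsLift n x) (K : ℤ) :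
    ∑ i : Fin n, x (i + K) = ∑ i : Fin n, x i + K := by
  have key : ∀ {y : ℤ → ℝ}, IsLift n y → ∑ i : Fin n, y (i + 1) = ∑ i : Fin n, y i + 1 := by
    intro y hy
    have h1 := Fin.sum_univ_eq_sum_range (fun i => y (i + 1)) n
    have h2 := Fin.sum_univ_eq_sum_range (fun i => y i) n
    rw [h1, h2]
    have h3 := Finset.sum_range_succ (fun i : ℕ => y i) n
    rw [Finset.sum_range_succ'] at h3
    have h4 := hy 0
    rw [zero_add] at h4
    push_cast at h3
    rw [h4] at h3
    linarith
  induction K with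
  | zero => simp
  | succ k ih =>
    have := key (hx.shift k)
    simp only [ih] at this
    have h1 : ∀ i : Fin n, (i : ℤ) + 1 + k = i + (k + 1 : ℤ) := fun i => by ring
    simp only [h1] at this
    push_cast at this ⊢
    linarith
  | pred k ih =>
    have := key (hx.shift (-k - 1))
    have h1 : ∀ i : Fin n, (i : ℤ) + 1 + (-k - 1) = i + -k := fun i => by ring
    simp only [h1, ih] at this
    push_cast at this ⊢
    linarith

/-- The point of the symmetric product with lift `x`. -/
def toSym (n : ℕ) (x : ℤ → ℝ) : SymCircle n := SymCircle.mk fun i => Circle.exp (2 * π * x i)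

theorem continuous_toSym : Continuous (toSym n) :=
  continuous_quotient_mk'.comp (continuous_pi fun i =>
    Circle.exp.continuous.comp (continuous_const.mul (continuous_apply (i : ℤ))))

theorem symProd_toSym (x : ℤ → ℝ) :
    symProd n (toSym n x) = Circle.exp (2 * π * ∑ i : Fin n, x i) := by
  change ∏ i : Fin n, Circle.exp (2 * π * x i) = _
  rw [Finset.mul_sum]
  exact (map_sum Circle.expHom (fun i : Fin n => 2 * π * x i) Finset.univ).symm

/-- The residue modulo `n` as an element of `Fin n`. -/
def residue (hn : 0 < n) (i : ℤ) : Fin n :=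
  ⟨(i % n).toNat, by
    have := Int.emod_nonneg i (b := n) (by omega)
    have := Int.emod_lt_of_pos i (b := n) (by omega)
    omega⟩

theorem residue_val (hn : 0 < n) (i : ℤ) : ((residue hn i : ℕ) : ℤ) = i % n :=
  Int.toNat_of_nonneg (Int.emod_nonneg i (by omega))

/-- Adding `K` permutes the residues modulo `n`, and the integer quotients disappear under the
exponential. -/
theorem IsLift.toSym_shift (hn : 0 < n) {x : ℤ → ℝ} (hx : IsLift n x) (K : ℤ) :
    toSym n (fun i => x (i + K)) = toSym n x := by
  have hinj : Function.Injective fun i : Fin n => residue hn (i + K) := by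
    intro i j hij
    have h1 : (i + K) % n = (j + K) % n := by
      rw [← residue_val hn, ← residue_val hn]
      exact congrArg (fun k : Fin n => (k : ℤ)) hij
    have h2 : (i : ℤ) % n = j % n := Int.ModEq.add_right_cancel' K h1
    rw [Int.emod_eq_of_lt (by omega) (by omega), Int.emod_eq_of_lt (by omega) (by omega)] at h2
    exact Fin.ext (by exact_mod_cast h2)
  refine (Quotient.sound ⟨Equiv.ofBijective _ (Finite.injective_iff_bijective.1 hinj),
    fun i => ?_⟩ : toSym n x = _).symm
  refine exp_two_pi_eq_iff.2 ⟨(i + K) / n, ?_⟩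
  rw [Equiv.ofBijective_apply, residue_val]
  exact hx.eq_emod _

/-- The remainders of `v j - a` modulo `n` run through `0, …, n - 1`, and each nonnegative integer
is at least its remainder. -/
theorem sum_le_sum_of_distinct_residues (hn : 0 < n) (v : Fin n → ℤ) (a : ℤ) (ha : ∀ j, a ≤ v j)
    (hv : ∀ i j, v i % n = v j % n → i = j) : n * a + ∑ j : Fin n, (j : ℤ) ≤ ∑ j, v j := by
  have hinj : Function.Injective fun i : Fin n => residue hn (v i - a) := by
    intro i j hij
    have h1 : (v i - a) % n = (v j - a) % n := by
      rw [← residue_val hn, ← residue_val hn]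
      exact congrArg (fun k : Fin n => (k : ℤ)) hij
    have h2 : v i - a + a ≡ v j - a + a [ZMOD n] := Int.ModEq.add_right a h1
    rw [sub_add_cancel, sub_add_cancel] at h2
    exact hv i j h2
  have h1 := (Finite.injective_iff_bijective.1 hinj).sum_comp (fun j : Fin n => (j : ℤ))
  rw [← h1]
  have h2 : (n : ℤ) * a = ∑ j : Fin n, a := by simp
  rw [h2, ← Finset.sum_add_distrib]
  refine Finset.sum_le_sum fun j _ => ?_
  rw [residue_val]
  have h3 := Int.emod_add_mul_ediv (v j - a) n
  have h4 : 0 ≤ (v j - a) / n := Int.ediv_nonneg (by linarith [ha j]) (by omega)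
  have h5 : 0 ≤ n * ((v j - a) / n) := mul_nonneg (by omega) h4
  linarith

/-- If `x i < y i`, monotonicity forces `τ j ≥ i + 1` for `j ≥ i`, and `τ j + n ≥ i + 1` for `j <
i`. These corrected indices still have distinct residues, but their sum is too small by `n` for such
a lower bound. -/
theorem le_of_rearrangement (hn : 0 < n) {x y : ℤ → ℝ} (hx : IsLift n x) (hxm : Monotone x)
    (hy : IsLift n y) (hym : Monotone y) (τ : Fin n → ℤ) (hτ : ∀ i j, τ i % n = τ j % n → i = j)
    (hsum : ∑ i, τ i = ∑ i : Fin n, (i : ℤ)) (h : ∀ i : Fin n, y i = x (τ i)) (i : Fin n) :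
    y i ≤ x i := by
  by_contra! hlt
  have h1 := sum_le_sum_of_distinct_residues hn (fun j => τ j + if j < i then (n : ℤ) else 0)
    (i + 1) ?_ ?_
  · rw [Finset.sum_add_distrib, hsum, ← Finset.sum_filter, Finset.sum_const,
      Finset.filter_gt_eq_Iio, Fin.card_Iio] at h1
    simp only [nsmul_eq_mul] at h1
    nlinarith
  · intro j
    rw [Int.add_one_le_iff]
    by_contra! hle
    split_ifs at hle with hji
    · have h2 := hxm hle
      rw [hx, ← h, ← hy] at h2
      have h3 : y i ≤ y (j + n) := hym (by omega)
      linarith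
    · have h2 := hxm hle
      rw [add_zero, ← h] at h2
      have h3 : y i ≤ y j := hym (by omega)
      linarith
  · intro j k hjk
    apply hτ
    split_ifs at hjk <;> simpa using hjk

/-- Sorted lifts of the same point differ by a permutation and integers. After a shift that
equalises the sums, a one-sided termwise inequality already forces equality. -/
theorem IsLift.exists_shift (hn : 0 < n) {x y : ℤ → ℝ} (hx : IsLift n x) (hxm : Monotone x)
    (hy : IsLift n y) (hym : Monotone y) (h : toSym n x = toSym n y) :
    ∃ K : ℤ, ∀ i, y i = x (i + K) := by
  obtain ⟨σ, hσ⟩ := Quotient.exact h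
  choose k hk using fun i => exp_two_pi_eq_iff.1 (hσ i)
  -- The only possible shift: a shift by `K` changes the sum over a period by `K`.
  let K := ∑ i, k i
  refine ⟨K, ?_⟩
  have hle := le_of_rearrangement hn (hx.shift K) (fun i j hij => hxm (by linarith)) hy hym
    (fun i => σ i + n * k i - K) ?_ ?_ ?_
  · have hs : ∑ i : Fin n, y i = ∑ i : Fin n, x (i + K) := by
      rw [hx.sum_shift, Finset.sum_congr rfl fun i _ => hk i, Finset.sum_add_distrib,
        Equiv.sum_comp σ fun i => x i]
      push_cast [K]
      rfl
    have heq := (Finset.sum_eq_sum_iff_of_le fun i _ => hle i).1 hs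
    intro i
    have h1 := heq (residue hn i) (Finset.mem_univ _)
    rw [residue_val] at h1
    rw [hy.eq_emod, h1]
    exact ((hx.shift K).eq_emod i).symm
  · intro i j hij
    have h1 : (σ i : ℤ) % n = σ j % n := by
      have := Int.ModEq.add_right K hij
      simpa [Int.ModEq] using this
    rw [Int.emod_eq_of_lt (by omega) (by omega), Int.emod_eq_of_lt (by omega) (by omega)] at h1
    exact σ.injective (Fin.ext (by exact_mod_cast h1))
  · rw [Finset.sum_sub_distrib, Finset.sum_add_distrib, ← Finset.mul_sum,
      Equiv.sum_comp σ fun i => (i : ℤ)]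
    simp [K]
  · intro i
    rw [hk i, sub_add_cancel, hx.add_mul]

/-- A fundamental domain for the action of the shift on the sorted lifts. -/
def fundamentalLifts (n : ℕ) : Set (ℤ → ℝ) := {x | IsLift n x ∧ Monotone x ∧ 0 ≤ x 0 ∧ x 0 ≤ 1}

/-- Monotonicity and periodicity confine each coordinate to a bounded interval, and the defining
conditions are closed in the product topology. -/
theorem isCompact_fundamentalLifts (hn : 0 < n) : IsCompact (fundamentalLifts n) := by
  refine IsCompact.of_isClosed_subset (isCompact_univ_pi fun i : ℤ =>
    isCompact_Icc (a := ((i / n : ℤ) : ℝ)) (b := (i / n : ℤ) + 2)) ?_ ?_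
  · have hc : ∀ i : ℤ, Continuous fun x : ℤ → ℝ => x i := fun i => continuous_apply i
    simp only [fundamentalLifts, IsLift, Monotone, Set.ofPred_and, Set.ofPred_forall]
    refine IsClosed.inter (isClosed_iInter fun i => isClosed_eq (hc _) ((hc _).add_const _)) ?_
    refine IsClosed.inter (isClosed_iInter fun i => isClosed_iInter fun j => isClosed_iInter fun _ =>
      isClosed_le (hc _) (hc _)) ?_
    exact (isClosed_le continuous_const (hc _)).inter (isClosed_le (hc _) continuous_const)
  · rintro x ⟨hx, hxm, h0, h1⟩ i -
    have h2 := Int.emod_nonneg i (b := n) (by omega)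
    have h3 := Int.emod_lt_of_pos i (b := n) (by omega)
    have h4 := hxm h2
    have h5 : x (i % n) ≤ x (0 + n) := hxm (by omega)
    rw [hx] at h5
    rw [Set.mem_Icc, hx.eq_emod]
    constructor <;> linarith

/-- The arguments are chosen in `[0, 1)`, sorted, and extended periodically. -/
theorem exists_fundamentalLift (hn : 0 < n) (c : SymCircle n) :
    ∃ x ∈ fundamentalLifts n, toSym n x = c := by
  obtain ⟨z, rfl⟩ := Quotient.exists_rep c
  choose t ht0 ht1 ht using fun i => exists_exp_two_pi_eq (z i)
  let s : Fin n → ℝ := fun i => t (Tuple.sort t i)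
  have hs : Monotone s := Tuple.monotone_sort t
  let x : ℤ → ℝ := fun i => s (residue hn i) + (i / n : ℤ)
  have hx : IsLift n x := by
    intro i
    have h1 : residue hn (i + n) = residue hn i := by
      simp [residue]
    have h2 : (i + n) / n = i / n + 1 := Int.add_ediv_of_dvd_right (dvd_refl _) |>.trans (by
      rw [Int.ediv_self (by omega)])
    simp only [x, h1, h2]
    push_cast
    ring
  have hxm : Monotone x := by
    intro i j hij
    rcases (Int.ediv_le_ediv (c := n) (by omega) hij).eq_or_lt with h | h
    · have h1 : residue hn i ≤ residue hn j := by
        have := Int.emod_add_mul_ediv i n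
        have := Int.emod_add_mul_ediv j n
        rw [h] at *
        rw [Fin.le_def]
        have := residue_val hn i
        have := residue_val hn j
        omega
      simp only [x, h]
      linarith [hs h1]
    · have h1 : ((i / n : ℤ) : ℝ) + 1 ≤ (j / n : ℤ) := by exact_mod_cast h
      have h2 : s (residue hn i) < 1 := ht1 _
      have h3 : 0 ≤ s (residue hn j) := ht0 _
      simp only [x]
      linarith
  refine ⟨x, ⟨hx, hxm, ?_, ?_⟩, ?_⟩
  · simpa [x] using ht0 (Tuple.sort t (residue hn 0))
  · simpa [x] using (ht1 (Tuple.sort t (residue hn 0))).le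
  · refine (Quotient.sound ⟨Tuple.sort t, fun i => ?_⟩ : SymCircle.mk z = _).symm
    rw [← ht]
    refine exp_two_pi_eq_iff.2 ⟨0, ?_⟩
    have h1 : ((i : ℕ) : ℤ) % n = i := Int.emod_eq_of_lt (by omega) (by omega)
    have h2 : ((i : ℕ) : ℤ) / n = 0 := Int.ediv_eq_zero_of_lt (by omega) (by omega)
    have h3 : residue hn i = i := Fin.ext (by have := residue_val hn i; omega)
    simp only [x, h2, h3]
    simp [s]

/-- The deformation of a lift to the equally spaced lift with the same sum. -/
def deform (n : ℕ) (t : ℝ) (x : ℤ → ℝ) (i : ℤ) : ℝ :=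
  (1 - t) * x i + t * ((∑ j : Fin n, x j) / n + (2 * i - n + 1) / (2 * n))

theorem isLift_deform (hn : 0 < n) (t : ℝ) {x : ℤ → ℝ} (hx : IsLift n x) :
    IsLift n (deform n t x) := by
  intro i
  have : (n : ℝ) ≠ 0 := by positivity
  simp only [deform, hx i]
  push_cast
  field_simp
  ring

/-- The target has spacing `1 / n` and its offsets sum to zero over a period. A shift by `K` raises
the mean by `K / n`, which is exactly `K` spacings. -/
theorem deform_shift (hn : 0 < n) (t : ℝ) {x : ℤ → ℝ} (hx : IsLift n x) (K : ℤ) :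
    deform n t (fun i => x (i + K)) = fun i => deform n t x (i + K) := by
  ext i
  have : (n : ℝ) ≠ 0 := by positivity
  simp only [deform, hx.sum_shift]
  push_cast
  field_simp
  ring

theorem continuous_deform : Continuous fun p : (ℤ → ℝ) × ℝ => deform n p.2 p.1 := by
  unfold deform
  fun_prop

theorem toSym_deform_eq (hn : 0 < n) (t : ℝ) {x y : ℤ → ℝ} (hx : x ∈ fundamentalLifts n)
    (hy : y ∈ fundamentalLifts n) (h : toSym n x = toSym n y) :
    toSym n (deform n t x) = toSym n (deform n t y) := by
  obtain ⟨K, hK⟩ := hx.1.exists_shift hn hx.2.1 hy.1 hy.2.1 h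
  rw [funext hK, deform_shift hn t hx.1, (isLift_deform hn t hx.1).toSym_shift hn]

/-- Equal products mean that the sums differ by an integer `K`, so the equally spaced lifts differ
by a shift by `K`. -/
theorem toSym_deform_one_eq (hn : 0 < n) {x y : ℤ → ℝ} (hx : IsLift n x)
    (h : symProd n (toSym n x) = symProd n (toSym n y)) :
    toSym n (deform n 1 x) = toSym n (deform n 1 y) := by
  rw [symProd_toSym, symProd_toSym, eq_comm, exp_two_pi_eq_iff] at h
  obtain ⟨K, hK⟩ := h
  have h1 : deform n 1 y = fun i => deform n 1 x (i + K) := by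
    ext i
    have : (n : ℝ) ≠ 0 := by positivity
    simp only [deform, hK]
    push_cast
    field_simp
    ring
  rw [h1, (isLift_deform hn 1 hx).toSym_shift hn]

/-- The polynomial with the given roots, seen as a function of `w`, separates points. The Hausdorff
property makes surjections from compact spaces quotient maps. -/
instance : T2Space (SymCircle n) := by
  let φ : SymCircle n → ℂ → ℂ := fun c w =>
    Quotient.lift (fun z : Fin n → Circle => ∏ i, (w - (z i : ℂ))) (by
      rintro x y ⟨σ, h⟩
      simp only [h]
      exact (Equiv.prod_comp σ fun i => w - (x i : ℂ)).symm) c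
  have hφ : Continuous φ := continuous_pi fun w => Continuous.quotient_lift (by fun_prop) _
  refine T2Space.of_injective_continuous (f := φ) ?_ hφ
  rintro ⟨x⟩ ⟨y⟩ h
  have h1 : ∏ i, (Polynomial.X - Polynomial.C (x i : ℂ)) =
      ∏ i, (Polynomial.X - Polynomial.C (y i : ℂ)) := by
    refine Polynomial.funext fun w => ?_
    rw [Polynomial.eval_prod, Polynomial.eval_prod]
    simpa using congrFun h w
  obtain ⟨σ, hσ⟩ := exists_perm_of_prod_X_sub_C_eq _ _ h1
  exact Quotient.sound ⟨σ, fun i => Circle.ext (hσ i)⟩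

/-- The symmetric product deforms to a subspace that is mapped injectively to the circle. -/
theorem exists_symCircle_deformation (hn : 0 < n) : ∃ g : C(SymCircle n, SymCircle n),
    (ContinuousMap.id _).Homotopic g ∧ ∀ c c', symProd n c = symProd n c' → g c = g c' := by
  have : CompactSpace (fundamentalLifts n) :=
    isCompact_iff_compactSpace.1 (isCompact_fundamentalLifts hn)
  let p : C(unitInterval × fundamentalLifts n, unitInterval × SymCircle n) :=
    ⟨fun q => (q.1, toSym n q.2), by
      exact continuous_fst.prodMk
        (continuous_toSym.comp (continuous_subtype_val.comp continuous_snd))⟩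
  -- Keeping the interval factor in both source and target makes the whole homotopy descend at once.
  have hp : Topology.IsQuotientMap p := by
    refine Topology.IsQuotientMap.of_surjective_continuous ?_ p.continuous
    rintro ⟨t, c⟩
    obtain ⟨x, hx, rfl⟩ := exists_fundamentalLift hn c
    exact ⟨(t, ⟨x, hx⟩), rfl⟩
  let q : C(unitInterval × fundamentalLifts n, SymCircle n) :=
    ⟨fun q => toSym n (deform n q.1 q.2), by
      refine continuous_toSym.comp (continuous_deform.comp (Continuous.prodMk ?_ ?_)) <;> fun_prop⟩
  have hq : Function.FactorsThrough q p := by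
    rintro ⟨t, x⟩ ⟨t', y⟩ h
    obtain ⟨rfl, h⟩ := Prod.ext_iff.1 h
    exact toSym_deform_eq hn t x.2 y.2 h
  let H := hp.lift q hq
  have hH : ∀ t (x : fundamentalLifts n), H (t, toSym n x) = toSym n (deform n t x) :=
    fun t x => DFunLike.congr_fun (hp.lift_comp q hq) (t, x)
  refine ⟨⟨fun c => H (1, c), by fun_prop⟩, ⟨⟨H, ?_, ?_⟩⟩, ?_⟩
  · intro c
    obtain ⟨x, hx, rfl⟩ := exists_fundamentalLift hn c
    refine (hH 0 ⟨x, hx⟩).trans (congrArg _ (funext fun i => ?_))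
    simp [deform]
  · intro c
    rfl
  · intro c c' h
    obtain ⟨x, hx, rfl⟩ := exists_fundamentalLift hn c
    obtain ⟨y, hy, rfl⟩ := exists_fundamentalLift hn c'
    refine (hH 1 ⟨x, hx⟩).trans (Eq.trans ?_ (hH 1 ⟨y, hy⟩).symm)
    exact toSym_deform_one_eq hn hx.1 h

/-- The section `z ↦ [z, 1, …, 1]` of the product map. -/
def symSection (hn : 0 < n) : C(Circle, SymCircle n) where
  toFun z := SymCircle.mk (Function.update 1 ⟨0, hn⟩ z)
  continuous_toFun := continuous_quotient_mk'.comp (continuous_const.update _ continuous_id)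

theorem symProd_symSection (hn : 0 < n) (z : Circle) : symProd n (symSection hn z) = z := by
  change ∏ i, Function.update (1 : Fin n → Circle) ⟨0, hn⟩ z i = z
  rw [Finset.prod_update_of_mem (Finset.mem_univ _)]
  simp

/-- The product map is a homotopy equivalence. -/
def symHomotopyEquiv (hn : 0 < n) : ContinuousMap.HomotopyEquiv (SymCircle n) Circle where
  toFun := symProd n
  invFun := symSection hn
  left_inv := by
    obtain ⟨g, hg, h⟩ := exists_symCircle_deformation hn
    -- With `g` homotopic to the identity and constant on fibres of the product, section after
    -- product is homotopic to `g` after both, which is `g` itself.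
    have h1 := hg.comp (ContinuousMap.Homotopic.refl ((symSection hn).comp (symProd n)))
    have h2 : g.comp ((symSection hn).comp (symProd n)) = g := by
      ext c
      exact h _ _ (symProd_symSection hn _)
    rw [h2, ContinuousMap.id_comp] at h1
    exact h1.trans hg.symm
  right_inv := by
    have : (symProd n).comp (symSection hn) = ContinuousMap.id _ :=
      ContinuousMap.ext fun z => symProd_symSection hn z
    rw [this]

end SymmetricProduct

/-! ## Functions on the circle -/

section CircleFunctions

open Real unitInterval

/-- The loop `t ↦ exp(2πit)` around the circle. -/
def circleLoop : C(I, Circle) := ⟨fun t => Circle.exp (2 * π * t), by fun_prop⟩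

theorem circleLoop_zero : circleLoop 0 = 1 := by simp [circleLoop]

theorem circleLoop_one : circleLoop 1 = 1 := by simp [circleLoop]

theorem isQuotientMap_circleLoop : Topology.IsQuotientMap circleLoop := by
  refine Topology.IsQuotientMap.of_surjective_continuous (fun z => ?_) circleLoop.continuous
  obtain ⟨t, h0, h1, rfl⟩ := exists_exp_two_pi_eq z
  exact ⟨⟨t, h0, h1.le⟩, rfl⟩

theorem factorsThrough_circleLoop {Y : Type*} [TopologicalSpace Y] (g : C(I, Y)) (h : g 0 = g 1) :
    Function.FactorsThrough g circleLoop := by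
  intro s t hst
  obtain ⟨k, hk⟩ := exp_two_pi_eq_iff.1 hst
  have h1 := s.2.1
  have h2 := s.2.2
  have h3 := t.2.1
  have h4 := t.2.2
  have h5 : (-2 : ℝ) < k := by linarith
  have h6 : (k : ℝ) < 2 := by linarith
  have h5 : -2 < k := by exact_mod_cast h5
  have h6 : k < 2 := by exact_mod_cast h6
  obtain rfl | rfl | rfl : k = -1 ∨ k = 0 ∨ k = 1 := by omega
  · push_cast at hk
    have hs : s = 0 := Subtype.ext (by rw [Set.Icc.coe_zero]; linarith)
    have ht : t = 1 := Subtype.ext (by rw [Set.Icc.coe_one]; linarith)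
    rw [hs, ht, h]
  · rw [show s = t from Subtype.ext (by simpa using hk)]
  · push_cast at hk
    have hs : s = 1 := Subtype.ext (by rw [Set.Icc.coe_one]; linarith)
    have ht : t = 0 := Subtype.ext (by rw [Set.Icc.coe_zero]; linarith)
    rw [hs, ht, h]

/-- A map on the interval with equal values at the end points descends to the circle. -/
theorem exists_circle_descent {Y : Type*} [TopologicalSpace Y] (g : C(I, Y)) (h : g 0 = g 1) :
    ∃ G : C(Circle, Y), ∀ t, G (circleLoop t) = g t :=
  ⟨isQuotientMap_circleLoop.lift g (factorsThrough_circleLoop g h), fun t =>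
    DFunLike.congr_fun (isQuotientMap_circleLoop.lift_comp g (factorsThrough_circleLoop g h)) t⟩

theorem coe_circleLoop_zpow (t : I) (k : ℤ) :
    ((circleLoop t ^ k : Circle) : ℂ) = Complex.exp (2 * π * Complex.I * k * t) := by
  rw [Circle.coe_zpow, circleLoop, ContinuousMap.coe_mk, Circle.coe_exp, ← Complex.exp_int_mul]
  push_cast
  ring_nf

/-- Lift `f` along the loop through `exp`. The end points of the lift differ by `2πik`, and
subtracting a linear term of that slope gives a function which descends to the circle. -/
theorem exists_eq_zpow_mul_exp (f : C(Circle, ℂ)) (hf : ∀ z, f z ≠ 0) :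
    ∃ (k : ℤ) (g : C(Circle, ℂ)), ∀ z, f z = ((z ^ k : Circle) : ℂ) * Complex.exp (g z) := by
  let γ : C(I, {z : ℂ // z ≠ 0}) := ⟨fun t => ⟨f (circleLoop t), hf _⟩, by fun_prop⟩
  obtain ⟨Γ, hΓ, -⟩ := Complex.isCoveringMap_exp.exists_path_lifts γ (Complex.log (f 1))
    (Subtype.ext (by simp [γ, circleLoop_zero, Complex.exp_log (hf 1)]))
  have hΓ' : ∀ t, Complex.exp (Γ t) = f (circleLoop t) := fun t =>
    congrArg Subtype.val (congrFun hΓ t)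
  have h1 : Complex.exp (Γ 1) = Complex.exp (Γ 0) := by
    rw [hΓ', hΓ', circleLoop_zero, circleLoop_one]
  obtain ⟨k, hk⟩ := Complex.exp_eq_exp_iff_exists_int.1 h1
  obtain ⟨g, hg⟩ := exists_circle_descent
    (⟨fun t => Γ t - 2 * π * Complex.I * k * (t : ℝ), by fun_prop⟩ : C(I, ℂ)) (by
      simp only [ContinuousMap.coe_mk, hk, Set.Icc.coe_zero, Set.Icc.coe_one]
      push_cast
      ring)
  refine ⟨k, g, fun z => ?_⟩
  obtain ⟨t, rfl⟩ := isQuotientMap_circleLoop.surjective z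
  rw [hg, coe_circleLoop_zpow, ← Complex.exp_add, ← hΓ']
  congr 1
  simp

/-- Along the loop, `g` and `t ↦ g 1 + 2πikt` lift the same path through `exp` and start together,
so they coincide; since `g` returns to its starting value, `k` vanishes. -/
theorem eq_zero_of_zpow_eq_exp {k : ℤ} {g : C(Circle, ℂ)}
    (h : ∀ z : Circle, ((z ^ k : Circle) : ℂ) = Complex.exp (g z)) : k = 0 := by
  have h1 := h 1
  rw [one_zpow, Circle.coe_one] at h1
  have h2 : (fun t : I => g (circleLoop t)) =
      fun t : I => g 1 + 2 * π * Complex.I * k * (t : ℝ) := by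
    refine Complex.isCoveringMap_exp.eq_of_comp_eq (by fun_prop) (by fun_prop) ?_ 0 ?_
    · ext t
      simp only [Function.comp_apply]
      rw [← h, coe_circleLoop_zpow, Complex.exp_add, ← h1, one_mul]
    · simp [circleLoop_zero]
  have h3 := congrFun h2 1
  simp only [circleLoop_one, Set.Icc.coe_one, left_eq_add, Complex.ofReal_one, mul_one] at h3
  simpa [Real.pi_ne_zero] using h3

/-- The homotopy lifts through the covering `exp`, starting from the logarithm 0 of the constant 1.
-/
theorem exists_log_of_homotopy {X : Type*} [TopologicalSpace X] (H : C(I × X, ℂ))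
    (hH : ∀ p, H p ≠ 0) (h0 : ∀ x, H (0, x) = 1) :
    ∃ g : C(X, ℂ), ∀ x, H (1, x) = Complex.exp (g x) := by
  let H' : C(I × X, {z : ℂ // z ≠ 0}) := ⟨fun p => ⟨H p, hH p⟩, by fun_prop⟩
  have h0' : ∀ x, H' (0, x) = ⟨Complex.exp ((0 : C(X, ℂ)) x), Complex.exp_ne_zero _⟩ := fun x =>
    Subtype.ext (by simp [H', h0])
  refine ⟨⟨fun x => Complex.isCoveringMap_exp.liftHomotopy H' 0 h0' (1, x), by fun_prop⟩,
    fun x => ?_⟩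
  have := congrFun (Complex.isCoveringMap_exp.liftHomotopy_lifts H' 0 h0') (1, x)
  exact (congrArg Subtype.val this).symm

theorem contDiff_of_mem_span_fourier {p : C(UnitAddCircle, ℂ)}
    (hp : p ∈ Submodule.span ℂ (Set.range (@fourier (1 : ℝ)))) :
    ContDiff ℝ 1 fun t : ℝ => p t := by
  induction hp using Submodule.span_induction with
  | mem x h =>
    obtain ⟨n, rfl⟩ := h
    simp only [fourier_coe_apply]
    exact ((contDiff_const.mul Complex.ofRealCLM.contDiff).div_const _).cexp
  | zero => exact contDiff_const
  | add x y _ _ hx hy => exact hx.add hy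
  | smul a x _ hx => exact contDiff_const.smul hx

/-- Approximate by a trigonometric polynomial. Its image is a smooth curve in the plane, so it
misses arbitrarily small values `c`; subtracting such a `c` removes all zeros. -/
theorem exists_ne_zero_near (v : C(Circle, ℂ)) {ε : ℝ} (hε : 0 < ε) :
    ∃ w : C(Circle, ℂ), (∀ z, w z ≠ 0) ∧ ∀ z, ‖w z - v z‖ < ε := by
  let e : UnitAddCircle ≃ₜ Circle := AddCircle.homeomorphCircle one_ne_zero
  let v' : C(UnitAddCircle, ℂ) := v.comp e
  have h1 : v' ∈ (Submodule.span ℂ (Set.range (@fourier (1 : ℝ)))).topologicalClosure := by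
    rw [span_fourier_closure_eq_top]
    trivial
  obtain ⟨p, hp, hpv⟩ := Metric.mem_closure_iff.1 h1 (ε / 2) (by positivity)
  have h2 := (contDiff_of_mem_span_fourier hp).dense_compl_range_of_finrank_lt_finrank
    (by rw [Module.finrank_self, Complex.finrank_real_complex]; norm_num)
  obtain ⟨c, hc, hcε⟩ := Metric.dense_iff.1 h2 0 (ε / 2) (by positivity)
  refine ⟨(p - ContinuousMap.const _ c).comp e.symm, fun z h => ?_, fun z => ?_⟩
  · obtain ⟨t, ht⟩ := QuotientAddGroup.mk_surjective (e.symm z)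
    refine hcε ⟨t, ?_⟩
    have h3 : p (e.symm z) - c = 0 := h
    rw [← ht] at h3
    exact sub_eq_zero.1 h3
  · have h3 : ‖p (e.symm z) - v' (e.symm z)‖ < ε / 2 := by
      rw [← dist_eq_norm, dist_comm]
      exact (ContinuousMap.dist_apply_le_dist _).trans_lt hpv
    have h4 : v' (e.symm z) = v z := by simp [v']
    rw [h4] at h3
    have h5 : ‖c‖ < ε / 2 := by simpa using hc
    calc ‖p (e.symm z) - c - v z‖ = ‖(p (e.symm z) - v z) - c‖ := by ring_nf
      _ ≤ ‖p (e.symm z) - v z‖ + ‖c‖ := norm_sub_le _ _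
      _ < ε := by linarith

end CircleFunctions

open unitInterval

/-! ## Maps to the general linear group -/

section GLMaps

open scoped MatrixGroups

variable {X Y Z : Type*} [TopologicalSpace X] [TopologicalSpace Y] [TopologicalSpace Z] {N : ℕ}

/-- The map to `GL_N(ℂ)` given by a continuous matrix function with nonvanishing determinant. -/
def glMap (A : X → Matrix (Fin N) (Fin N) ℂ) (hA : Continuous A) (h : ∀ x, (A x).det ≠ 0) :
    C(X, GL (Fin N) ℂ) where
  toFun x := Matrix.GeneralLinearGroup.mkOfDetNeZero (A x) (h x)
  continuous_toFun := by
    refine Units.continuous_iff.2 ⟨hA, ?_⟩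
    have h1 : (fun x => ((Matrix.GeneralLinearGroup.mkOfDetNeZero (A x) (h x))⁻¹).1) =
        fun x => (A x).det⁻¹ • (A x).adjugate := by
      ext1 x
      rw [Matrix.coe_units_inv, Matrix.inv_def, Ring.inverse_eq_inv']
      rfl
    rw [h1]
    exact (hA.matrix_det.inv₀ h).smul hA.matrix_adjugate

theorem glMap_val (A : X → Matrix (Fin N) (Fin N) ℂ) (hA : Continuous A) (h : ∀ x, (A x).det ≠ 0)
    (x : X) : (glMap A hA h x).1 = A x := rfl

theorem det_ne_zero (g : GL (Fin N) ℂ) : g.1.det ≠ 0 :=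
  ((Matrix.isUnit_iff_isUnit_det _).1 g.isUnit).ne_zero

theorem continuous_glVal (u : C(X, GL (Fin N) ℂ)) : Continuous fun x => (u x).1 :=
  Units.continuous_val.comp u.continuous

theorem homotopic_of_matrix_homotopy {u v : C(X, GL (Fin N) ℂ)}
    (A : I × X → Matrix (Fin N) (Fin N) ℂ) (hA : Continuous A) (h : ∀ p, (A p).det ≠ 0)
    (h0 : ∀ x, A (0, x) = (u x).1) (h1 : ∀ x, A (1, x) = (v x).1) : u.Homotopic v :=
  ⟨⟨glMap A hA h, fun x => Units.ext (h0 x), fun x => Units.ext (h1 x)⟩⟩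

/-- Every element of `GL_N(ℂ)` is joined to `1` by a path in the commutant of its commutant. -/
theorem exists_path_in_bicommutant (P : GL (Fin N) ℂ) : ∃ γ : C(I, GL (Fin N) ℂ), γ 0 = 1 ∧
    γ 1 = P ∧ ∀ t, ∀ M : Matrix (Fin N) (Fin N) ℂ, Commute P.1 M → Commute (γ t).1 M := by
  -- The determinant of `(1 - z) + z P` is a nonzero polynomial in `z`, being 1 at 0. Its finitely
  -- many zeros can be avoided by a path from 0 to 1 in the plane, and affine combinations of 1 and
  -- `P` commute with whatever `P` commutes with.
  let p : Polynomial ℂ := (((1 - Polynomial.X : Polynomial ℂ) • (1 : Matrix (Fin N) (Fin N) ℂ).map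
    Polynomial.C) + (Polynomial.X : Polynomial ℂ) • P.1.map Polynomial.C).det
  have hp : ∀ z : ℂ, p.eval z = ((1 - z) • (1 : Matrix (Fin N) (Fin N) ℂ) + z • P.1).det := by
    intro z
    rw [← Polynomial.coe_evalRingHom, RingHom.map_det]
    congr 1
    ext i j
    simp [Matrix.map_apply, Matrix.one_apply]
    split_ifs <;> simp [mul_comm]
  have hp0 : p ≠ 0 := by
    intro h
    have := hp 0
    simp [h] at this
  have hc : IsPathConnected ((p.rootSet ℂ)ᶜ : Set ℂ) :=
    (p.rootSet_finite ℂ).countable.isPathConnected_compl_of_one_lt_rank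
      (by rw [Complex.rank_real_complex]; norm_num)
  have hmem : ∀ z, z ∈ ((p.rootSet ℂ)ᶜ : Set ℂ) ↔
      ((1 - z) • (1 : Matrix (Fin N) (Fin N) ℂ) + z • P.1).det ≠ 0 := by
    intro z
    rw [Set.mem_compl_iff, Polynomial.mem_rootSet, ← hp]
    simp [hp0]
  obtain ⟨γ, hγ⟩ := hc.joinedIn 0 ((hmem 0).2 (by simp)) 1 ((hmem 1).2 (by simpa using det_ne_zero P))
  refine ⟨glMap (fun t => (1 - γ t) • (1 : Matrix (Fin N) (Fin N) ℂ) + γ t • P.1) (by fun_prop)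
    fun t => (hmem _).1 (hγ t), Units.ext ?_, Units.ext ?_, fun t M hM => ?_⟩
  · simp [glMap_val]
  · simp [glMap_val]
  · rw [glMap_val]
    exact ((Commute.one_left M).smul_left _).add_left (hM.smul_left _)

theorem homotopic_conj (P : GL (Fin N) ℂ) (u v : C(X, GL (Fin N) ℂ))
    (h : ∀ x, v x = P * u x * P⁻¹) : u.Homotopic v := by
  obtain ⟨γ, h0, h1, -⟩ := exists_path_in_bicommutant P
  refine ⟨⟨⟨fun p => γ p.1 * u p.2 * (γ p.1)⁻¹, by fun_prop⟩, fun x => ?_, fun x => ?_⟩⟩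
  · simp [h0]
  · simp [h1, h]

end GLMaps

/-! ## The group `K¹` -/

section KOne

open scoped MatrixGroups

variable {X Y Z : Type*} [TopologicalSpace X] [TopologicalSpace Y] [TopologicalSpace Z] {N : ℕ}

/-- The class in `K¹(X)` of a map to `GL_N(ℂ)`. -/
def KOne.mk (u : C(X, GL (Fin N) ℂ)) : KOne X :=
  Additive.ofMul (Quotient.mk (DirectLimit.setoid (fun N M h => stabiliseClass X N M h))
    ⟨N, (u : HomotopyClassGroup X (GL (Fin N) ℂ))⟩)

theorem KOne.exists_eq_mk (α : KOne X) : ∃ (N : ℕ) (u : C(X, GL (Fin N) ℂ)), α = KOne.mk u := by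
  obtain ⟨N, u, h⟩ := DirectLimit.exists_eq_mk (fun N M h => stabiliseClass X N M h) α.toMul
  obtain ⟨u, rfl⟩ := QuotientGroup.mk_surjective u
  exact ⟨N, u, congrArg Additive.ofMul h⟩

theorem homotopyClass_eq {G : Type*} [TopologicalSpace G] [Group G] [IsTopologicalGroup G]
    {u v : C(X, G)} (h : u.Homotopic v) :
    (u : HomotopyClassGroup X G) = v := by
  rw [QuotientGroup.eq]
  have h1 := (ContinuousMap.Homotopic.refl (⟨fun p : G × G => p.1 * p.2, continuous_mul⟩ :
    C(G × G, G))).comp ((ContinuousMap.Homotopic.refl u⁻¹).prodMk h)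
  have h2 : (⟨fun p : G × G => p.1 * p.2, continuous_mul⟩ : C(G × G, G)).comp (u⁻¹.prodMk u) = 1 := by
    ext x
    simp
  rw [h2] at h1
  exact h1.symm

theorem KOne.mk_eq_of_homotopic {u v : C(X, GL (Fin N) ℂ)} (h : u.Homotopic v) :
    KOne.mk u = KOne.mk v := by
  rw [KOne.mk, KOne.mk, homotopyClass_eq h]

theorem KOne.mk_mul (u v : C(X, GL (Fin N) ℂ)) : KOne.mk (u * v) = KOne.mk u + KOne.mk v := by
  have h := DirectLimit.mul_def (f := fun N M h => stabiliseClass X N M h) N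
    (QuotientGroup.mk u : HomotopyClassGroup X (GL (Fin N) ℂ))
    (QuotientGroup.mk v : HomotopyClassGroup X (GL (Fin N) ℂ))
  exact (congrArg Additive.ofMul h).symm

theorem KOne.mk_one : KOne.mk (1 : C(X, GL (Fin N) ℂ)) = 0 := by
  have := KOne.mk_mul (1 : C(X, GL (Fin N) ℂ)) 1
  rwa [mul_one, left_eq_add] at this

/-- The class map as a homomorphism. -/
def KOne.mkHom (X : Type*) [TopologicalSpace X] (N : ℕ) :
    Additive C(X, GL (Fin N) ℂ) →+ KOne X :=
  AddMonoidHom.mk' (fun u => KOne.mk u.toMul) fun u v => KOne.mk_mul u.toMul v.toMul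

theorem KOne.mk_zpow (u : C(X, GL (Fin N) ℂ)) (k : ℤ) : KOne.mk (u ^ k) = k • KOne.mk u :=
  map_zsmul (KOne.mkHom X N) k (Additive.ofMul u)

theorem KOne.mk_stabilise {M : ℕ} (h : N ≤ M) (u : C(X, GL (Fin N) ℂ)) :
    KOne.mk ((stabilise h : C(GL (Fin N) ℂ, GL (Fin M) ℂ)).comp u) = KOne.mk u := by
  have h := DirectLimit.eq_of_le (f := fun N M h => stabiliseClass X N M h)
    (⟨N, (QuotientGroup.mk u : HomotopyClassGroup X (GL (Fin N) ℂ))⟩ :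
      Σ N, HomotopyClassGroup X (GL (Fin N) ℂ)) M h
  exact (congrArg Additive.ofMul h).symm

theorem KOne.exists_homotopic_of_mk_eq_zero {u : C(X, GL (Fin N) ℂ)} (hu : KOne.mk u = 0) :
    ∃ (M : ℕ) (h : N ≤ M),
      ((stabilise h : C(GL (Fin N) ℂ, GL (Fin M) ℂ)).comp u).Homotopic 1 := by
  -- Zero is represented in size 0, so comparison with it puts no further condition on the common
  -- size `M`.
  rw [← KOne.mk_one (N := 0)] at hu
  obtain ⟨M, h, h', hM⟩ := Quotient.exact hu
  refine ⟨M, h, ?_⟩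
  have h1 := hM.trans (map_one (stabiliseClass X 0 M h'))
  exact (QuotientGroup.eq_one_iff _).1 h1

theorem KOne.map_mk (f : C(X, Y)) (u : C(Y, GL (Fin N) ℂ)) :
    KOne.map f (KOne.mk u) = KOne.mk (u.comp f) := rfl

theorem KOne.map_eq_of_homotopic {f g : C(X, Y)} (h : f.Homotopic g) : KOne.map f = KOne.map g := by
  ext α
  obtain ⟨N, u, rfl⟩ := α.exists_eq_mk
  rw [KOne.map_mk, KOne.map_mk]
  exact KOne.mk_eq_of_homotopic ((ContinuousMap.Homotopic.refl u).comp h)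

theorem KOne.map_map (f : C(X, Y)) (g : C(Y, Z)) (α : KOne Z) :
    KOne.map f (KOne.map g α) = KOne.map (g.comp f) α := by
  obtain ⟨N, u, rfl⟩ := α.exists_eq_mk
  rfl

theorem KOne.map_id (α : KOne X) : KOne.map (ContinuousMap.id X) α = α := by
  obtain ⟨N, u, rfl⟩ := α.exists_eq_mk
  rfl

theorem KOne.map_bijective (f : C(X, Y)) (g : C(Y, X))
    (h : (g.comp f).Homotopic (ContinuousMap.id X)) (h' : (f.comp g).Homotopic (ContinuousMap.id Y)) :
    Function.Bijective (KOne.map f) := by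
  refine Function.bijective_iff_has_inverse.2 ⟨KOne.map g, fun α => ?_, fun α => ?_⟩
  · rw [KOne.map_map, KOne.map_eq_of_homotopic h', KOne.map_id]
  · rw [KOne.map_map, KOne.map_eq_of_homotopic h, KOne.map_id]

end KOne

/-! ## The group `K¹` of the circle -/

section KOneCircle

open scoped MatrixGroups

variable {X : Type*} [TopologicalSpace X] {N : ℕ}

theorem det_diagonal_update (i : Fin N) (d : ℂ) :
    (Matrix.diagonal (Function.update (1 : Fin N → ℂ) i d)).det = d := by
  rw [Matrix.det_diagonal, Finset.prod_update_of_mem (Finset.mem_univ _)]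
  simp

/-- The diagonal matrix function with one entry `d` and all others equal to `1`. -/
def diagMap (i : Fin N) (d : C(X, ℂ)) (hd : ∀ x, d x ≠ 0) : C(X, GL (Fin N) ℂ) :=
  glMap (fun x => Matrix.diagonal (Function.update 1 i (d x)))
    (Continuous.matrix_diagonal (continuous_const.update i d.continuous))
    fun x => by rw [det_diagonal_update]; exact hd x

theorem diagMap_mul (i : Fin N) (d d' : C(X, ℂ)) (hd : ∀ x, d x ≠ 0) (hd' : ∀ x, d' x ≠ 0) :
    diagMap i (d * d') (fun x => mul_ne_zero (hd x) (hd' x)) = diagMap i d hd * diagMap i d' hd' := by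
  ext x : 2
  change Matrix.diagonal _ = Matrix.diagonal _ * Matrix.diagonal _
  rw [Matrix.diagonal_mul_diagonal]
  congr 1
  ext j
  by_cases h : j = i
  · subst h
    simp
  · simp [h]

theorem homotopic_diagMap_zero (i : Fin (N + 1)) (d : C(X, ℂ)) (hd : ∀ x, d x ≠ 0) :
    (diagMap i d hd).Homotopic (diagMap 0 d hd) := by
  refine homotopic_conj (permGL (Equiv.swap 0 i)) _ _ fun x => Units.ext ?_
  refine Eq.trans ?_ (permGL_conj _ _).symm
  change Matrix.diagonal _ = (Matrix.diagonal _).submatrix _ _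
  rw [Matrix.submatrix_diagonal_equiv]
  congr 1
  ext j
  simp only [Function.update_apply, Function.comp_apply, Equiv.swap_apply_eq_iff,
    Equiv.swap_apply_right, Pi.one_apply]

theorem stabilise_diagMap (h : 1 ≤ N + 1) (d : C(X, ℂ)) (hd : ∀ x, d x ≠ 0) :
    (stabilise h : C(GL (Fin 1) ℂ, GL (Fin (N + 1)) ℂ)).comp (diagMap 0 d hd) = diagMap 0 d hd := by
  ext x : 2
  change padMatrix (N + 1) (Matrix.diagonal _) = Matrix.diagonal _
  ext i j
  simp only [padMatrix, Matrix.of_apply, Matrix.diagonal_apply, Function.update_apply, Fin.ext_iff,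
    Fin.val_zero, Pi.one_apply, Nat.lt_one_iff]
  split_ifs <;> first | rfl | omega

/-- Conjugation by a permutation matrix, homotopically trivial, moves the entry to position 0;
stabilisation removes the dependence on `N`. -/
theorem KOne.mk_diagMap (i : Fin N) (d : C(X, ℂ)) (hd : ∀ x, d x ≠ 0) :
    KOne.mk (diagMap i d hd) = KOne.mk (diagMap (0 : Fin 1) d hd) := by
  obtain ⟨M, rfl⟩ : ∃ M, N = M + 1 := ⟨N - 1, by have := i.2; omega⟩
  rw [KOne.mk_eq_of_homotopic (homotopic_diagMap_zero i d hd),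
    ← stabilise_diagMap (Nat.le_add_left 1 M), KOne.mk_stabilise]

/-- The inclusion of the circle in the plane, raised to the power `k`. -/
def circlePow (k : ℤ) : C(Circle, ℂ) := 
  ⟨fun z => ((z ^ k : Circle) : ℂ), continuous_subtype_val.comp (continuous_zpow k)⟩

theorem circlePow_ne_zero (k : ℤ) (z : Circle) : circlePow k z ≠ 0 := Circle.coe_ne_zero _

/-- The generator of `K¹` of the circle. -/
def kOneGen : KOne Circle := KOne.mk (diagMap (0 : Fin 1) (circlePow 1) (circlePow_ne_zero 1))

theorem zsmul_kOneGen (k : ℤ) :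
    k • kOneGen = KOne.mk (diagMap (0 : Fin 1) (circlePow k) (circlePow_ne_zero k)) := by
  let φ : Multiplicative ℤ →* C(Circle, GL (Fin 1) ℂ) := MonoidHom.mk'
    (fun k => diagMap (0 : Fin 1) (circlePow k.toAdd) (circlePow_ne_zero k.toAdd)) fun k l => by
      rw [← diagMap_mul]
      congr 1
      ext z
      simp [circlePow, zpow_add]
  have h := map_zpow φ (Multiplicative.ofAdd 1) k
  rw [← Int.ofAdd_mul, one_mul] at h
  exact (KOne.mk_zpow _ k).symm.trans (congrArg KOne.mk h.symm)

/-- After stabilisation the class has a null-homotopy, whose determinant contracts `z ^ k` through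
nonvanishing functions; hence `z ^ k` has a logarithm. -/
theorem kOneGen_zsmul_eq_zero {k : ℤ} (h : k • kOneGen = 0) : k = 0 := by
  rw [zsmul_kOneGen] at h
  obtain ⟨M, hM, hH⟩ := KOne.exists_homotopic_of_mk_eq_zero h
  obtain ⟨m, rfl⟩ : ∃ m, M = m + 1 := ⟨M - 1, by omega⟩
  rw [stabilise_diagMap] at hH
  obtain ⟨H⟩ := hH.symm
  have hc : Continuous fun p => (H p).1.det :=
    (continuous_glVal H.toContinuousMap).matrix_det
  obtain ⟨g, hg⟩ := exists_log_of_homotopy ⟨_, hc⟩ (fun p => det_ne_zero _) (fun x => by simp)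
  refine eq_zero_of_zpow_eq_exp (g := g) fun z => ?_
  rw [← hg, ContinuousMap.coe_mk, H.apply_one]
  exact (det_diagonal_update _ _).symm

/-- Scaling the exponent `g` in `d = z ^ k * exp g` down to zero deforms `d` to `z ^ k`. -/
theorem KOne.mk_diagMap_mem (i : Fin N) (d : C(Circle, ℂ)) (hd : ∀ x, d x ≠ 0) :
    KOne.mk (diagMap i d hd) ∈ AddSubgroup.zmultiples kOneGen := by
  obtain ⟨k, g, h⟩ := exists_eq_zpow_mul_exp d hd
  refine ⟨k, ?_⟩
  change k • kOneGen = _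
  rw [zsmul_kOneGen, KOne.mk_diagMap i]
  refine KOne.mk_eq_of_homotopic (homotopic_of_matrix_homotopy
    (fun p => Matrix.diagonal (Function.update 1 0
      (circlePow k p.2 * Complex.exp ((p.1 : ℝ) * g p.2)))) ?_ ?_ ?_ ?_)
  · exact Continuous.matrix_diagonal (continuous_const.update 0 (by fun_prop))
  · intro p
    rw [det_diagonal_update]
    exact mul_ne_zero (circlePow_ne_zero _ _) (Complex.exp_ne_zero _)
  · intro x
    simp [diagMap, glMap_val]
  · intro x
    simp [diagMap, glMap_val, h, circlePow]

/-- By compactness of the circle, changes of one entry by less than a uniform `ε` preserve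
invertibility, and within `ε` there is a nowhere vanishing function. -/
theorem exists_homotopic_entry_ne_zero (u : C(Circle, GL (Fin N) ℂ)) (i : Fin N) :
    ∃ v : C(Circle, GL (Fin N) ℂ), u.Homotopic v ∧ ∀ x, (v x).1 i i ≠ 0 := by
  let A : ℂ × Circle → Matrix (Fin N) (Fin N) ℂ := fun p => (u p.2).1 + p.1 • Matrix.single i i 1
  have hu := continuous_glVal u
  have hA : Continuous A := by fun_prop
  obtain ⟨U, V, hU, -, hU0, hV, hUV⟩ := generalized_tube_lemma (s := {(0 : ℂ)}) (t := Set.univ)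
    isCompact_singleton isCompact_univ (isOpen_ne.preimage hA.matrix_det : IsOpen {p | (A p).det ≠ 0})
    (by
      rintro ⟨c, x⟩ ⟨hc, -⟩
      obtain rfl : c = 0 := hc
      simpa [A] using det_ne_zero (u x))
  obtain ⟨ε, hε, hεU⟩ := Metric.isOpen_iff.1 hU 0 (hU0 rfl)
  have hdet : ∀ (c : ℂ) (x : Circle), ‖c‖ < ε → (A (c, x)).det ≠ 0 := fun c x hc =>
    hUV (⟨hεU (by simpa using hc), hV trivial⟩ : (c, x) ∈ U ×ˢ V)
  let e : C(Circle, ℂ) := ⟨fun x => (u x).1 i i, hu.matrix_elem i i⟩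
  obtain ⟨w, hw, hwe⟩ := exists_ne_zero_near e hε
  have hwe' : ∀ x, A (w x - e x, x) i i = w x := fun x => by simp [A, e]
  refine ⟨glMap (fun x => A (w x - e x, x)) (by fun_prop) fun x => hdet _ _ (hwe x), ?_, ?_⟩
  · refine homotopic_of_matrix_homotopy (fun p => A ((p.1 : ℝ) * (w p.2 - e p.2), p.2))
      (by fun_prop) (fun p => hdet _ _ ?_) (fun x => ?_) (fun x => ?_)
    · rw [norm_mul, Complex.norm_real, Real.norm_of_nonneg p.1.2.1]
      exact (mul_le_of_le_one_left (norm_nonneg _) p.1.2.2).trans_lt (hwe _)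
    · simp [A]
    · simp [glMap_val]
  · intro x
    rw [glMap_val, hwe']
    exact hw x

/-- The correction `1 - s ^ 2` keeps the Schur complement, hence the determinant, independent of
`s`. This joins the block-diagonal matrix at `s = 0` to the original one at `s = 1`. -/
theorem blocks_schur {p q : Type*} [Fintype p] [Fintype q] [DecidableEq p] [DecidableEq q]
    (A : Matrix p p ℂ) (b : Matrix p q ℂ) (c : Matrix q p ℂ) {d : ℂ} (hd : d ≠ 0) (s : ℂ) :
    Matrix.fromBlocks (A - ((1 - s ^ 2) * d⁻¹) • (b * c)) (s • b) (s • c) (d • 1) =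
      Matrix.fromBlocks 1 ((s * d⁻¹) • b) 0 1 * Matrix.fromBlocks (A - d⁻¹ • (b * c)) 0 0 (d • 1) *
        Matrix.fromBlocks 1 0 ((s * d⁻¹) • c) 1 := by
  simp only [Matrix.fromBlocks_multiply, one_mul, mul_one, add_zero, zero_add,
    Matrix.smul_mul, Matrix.mul_smul, smul_smul, Matrix.one_mul, Matrix.zero_mul, Matrix.mul_zero,
    Matrix.mul_one]
  congr 1
  · have h1 : s * d⁻¹ * (d * (s * d⁻¹)) = s ^ 2 * d⁻¹ := by field_simp
    rw [h1, sub_mul, one_mul, sub_smul]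
    abel
  · congr 1
    field_simp
  · congr 1
    field_simp

/-- Gaussian elimination up to homotopy: once the last diagonal entry is nowhere zero, the matrix
deforms to its Schur complement plus that entry, and induction applies to the complement. -/
theorem KOne.mk_mem_zmultiples (u : C(Circle, GL (Fin N) ℂ)) :
    KOne.mk u ∈ AddSubgroup.zmultiples kOneGen := by
  induction N with
  | zero =>
    have : u = 1 := ContinuousMap.ext fun x => Subsingleton.elim _ _
    rw [this, KOne.mk_one]
    exact zero_mem _
  | succ N ih =>
    obtain ⟨v, huv, hv⟩ := exists_homotopic_entry_ne_zero u (Fin.last N)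
    rw [KOne.mk_eq_of_homotopic huv]
    have hvc := continuous_glVal v
    let e : Fin N ⊕ Fin 1 ≃ Fin (N + 1) := finSumFinEquiv
    let d : C(Circle, ℂ) := ⟨fun x => (v x).1 (Fin.last N) (Fin.last N), hvc.matrix_elem _ _⟩
    let B : Circle → Matrix (Fin N ⊕ Fin 1) (Fin N ⊕ Fin 1) ℂ := fun x => (v x).1.submatrix e e
    have hB : Continuous B := hvc.matrix_submatrix _ _
    let A' : Circle → Matrix (Fin N) (Fin N) ℂ := fun x =>
      (B x).toBlocks₁₁ - (d x)⁻¹ • ((B x).toBlocks₁₂ * (B x).toBlocks₂₁)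
    let M : I × Circle → Matrix (Fin N ⊕ Fin 1) (Fin N ⊕ Fin 1) ℂ := fun p =>
      Matrix.fromBlocks ((B p.2).toBlocks₁₁ - ((1 - ((p.1 : ℝ) : ℂ) ^ 2) * (d p.2)⁻¹) •
          ((B p.2).toBlocks₁₂ * (B p.2).toBlocks₂₁))
        (((p.1 : ℝ) : ℂ) • (B p.2).toBlocks₁₂) (((p.1 : ℝ) : ℂ) • (B p.2).toBlocks₂₁) (d p.2 • 1)
    have hM1 : ∀ x, M (1, x) = B x := by
      intro x
      have h1 : (B x).toBlocks₂₂ = d x • 1 := by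
        ext i j
        obtain rfl : i = 0 := Subsingleton.elim _ _
        obtain rfl : j = 0 := Subsingleton.elim _ _
        have h2 : e (Sum.inr 0) = Fin.last N := rfl
        rw [Matrix.smul_apply, Matrix.one_apply_eq, smul_eq_mul, mul_one]; rfl
      rw [← Matrix.fromBlocks_toBlocks (B x), h1]
      simp [M]
    have hMdet : ∀ p, (M p).det = (A' p.2).det * d p.2 := by
      intro p
      simp only [M]
      rw [blocks_schur _ _ _ (show d p.2 ≠ 0 from hv p.2)]
      simp [A', Matrix.det_fromBlocks_zero₂₁]
    have hne : ∀ x, (A' x).det * d x ≠ 0 := by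
      intro x
      rw [← hMdet (1, x), hM1]
      simpa [B] using det_ne_zero (v x)
    have hb : ∀ i j, Continuous fun x => B x i j := fun i j => hB.matrix_elem i j
    have hdinv : Continuous fun x => (d x)⁻¹ := d.continuous.inv₀ hv
    have hB₁₁ : Continuous fun x => (B x).toBlocks₁₁ := continuous_matrix fun i j => hb _ _
    have hB₁₂ : Continuous fun x => (B x).toBlocks₁₂ := continuous_matrix fun i j => hb _ _
    have hB₂₁ : Continuous fun x => (B x).toBlocks₂₁ := continuous_matrix fun i j => hb _ _
    have hA' : Continuous A' := hB₁₁.sub (hdinv.smul (hB₁₂.matrix_mul hB₂₁))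
    have hs : Continuous fun p : I × Circle => ((p.1 : ℝ) : ℂ) := by fun_prop
    have hMc : Continuous M := by
      refine Continuous.matrix_fromBlocks ?_ (hs.smul (hB₁₂.comp continuous_snd))
        (hs.smul (hB₂₁.comp continuous_snd)) ((d.continuous.comp continuous_snd).smul continuous_const)
      exact (hB₁₁.comp continuous_snd).sub
        (((continuous_const.sub (hs.pow 2)).mul (hdinv.comp continuous_snd)).smul
          ((hB₁₂.matrix_mul hB₂₁).comp continuous_snd))
    have h1 : v.Homotopic
        ((stabilise (Nat.le_succ N) : C(GL (Fin N) ℂ, GL (Fin (N + 1)) ℂ)).comp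
          (glMap A' hA' fun x => left_ne_zero_of_mul (hne x)) * diagMap (Fin.last N) d hv) := by
      refine ContinuousMap.Homotopic.symm (homotopic_of_matrix_homotopy
        (fun p => (M p).submatrix e.symm e.symm) (hMc.matrix_submatrix _ _) ?_ ?_ ?_)
      · intro p
        rw [Matrix.det_submatrix_equiv_self, hMdet]
        exact hne _
      · intro x
        change _ = padMatrix (N + 1) (A' x) * Matrix.diagonal (Function.update 1 (Fin.last N) (d x))
        have h0 : M (0, x) = Matrix.fromBlocks (A' x) 0 0 (d x • 1) := by simp [M, A']
        have h2 : ∀ i : Fin N, e.symm i.castSucc = Sum.inl i := finSumFinEquiv_symm_apply_castAdd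
        have h3 : e.symm (Fin.last N) = Sum.inr 0 := finSumFinEquiv_symm_apply_natAdd 0
        ext i j
        rw [h0, Matrix.mul_diagonal, Matrix.submatrix_apply]
        refine Fin.lastCases ?_ (fun i => ?_) i <;> refine Fin.lastCases ?_ (fun j => ?_) j
        · simp [h3, padMatrix]
        · simp [h2, h3, padMatrix, Fin.ext_iff, j.2.ne']
        · simp [h2, h3, padMatrix, Fin.ext_iff, i.2.ne]
        · simp [h2, padMatrix]
      · intro x
        rw [hM1]
        simp [B]
    rw [KOne.mk_eq_of_homotopic h1, KOne.mk_mul, KOne.mk_stabilise]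
    exact add_mem (ih _) (KOne.mk_diagMap_mem _ _ _)

/-- `K¹` of the circle is infinite cyclic. -/
def kOneCircleEquiv : KOne Circle ≃+ ℤ :=
  (AddEquiv.ofBijective (zmultiplesHom (KOne Circle) kOneGen) ⟨by
    rw [injective_iff_map_eq_zero]
    exact fun k hk => kOneGen_zsmul_eq_zero hk, fun α => by
    obtain ⟨N, u, rfl⟩ := α.exists_eq_mk
    exact KOne.mk_mem_zmultiples u⟩).symm

/-- The map `z ↦ z ^ f` of the circle. -/
def circlePowMap (f : ℕ) : C(Circle, Circle) := ⟨fun z => z ^ f, by fun_prop⟩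

theorem KOne.map_circlePowMap (f : ℕ) (α : KOne Circle) :
    KOne.map (circlePowMap f) α = f • α := by
  obtain ⟨k, rfl⟩ : ∃ k : ℤ, k • kOneGen = α := by
    obtain ⟨N, u, rfl⟩ := α.exists_eq_mk
    exact KOne.mk_mem_zmultiples u
  rw [map_zsmul, ← natCast_zsmul, smul_comm]
  congr 1
  rw [zsmul_kOneGen]
  refine congrArg KOne.mk (ContinuousMap.ext fun z => Units.ext ?_)
  change Matrix.diagonal _ = Matrix.diagonal _
  simp [circlePow, circlePowMap]

end KOneCircle

/-! ## Idempotent matrices of continuous functions -/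

section FunctionMatrices

variable {X Y Z : Type*} [TopologicalSpace X] [TopologicalSpace Y] [TopologicalSpace Z]
  {l m n : Type*}

/-- The value at a point of a matrix of continuous functions. -/
def fnValue (A : Matrix m n C(X, ℂ)) (x : X) : Matrix m n ℂ := A.map fun f => f x

/-- The matrix of functions given by a continuous matrix-valued function. -/
def fnMatrix (A : X → Matrix m n ℂ) (hA : Continuous A) : Matrix m n C(X, ℂ) :=
  Matrix.of fun i j => ⟨fun x => A x i j, hA.matrix_elem i j⟩

theorem fnValue_fnMatrix (A : X → Matrix m n ℂ) (hA : Continuous A) (x : X) :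
    fnValue (fnMatrix A hA) x = A x := rfl

theorem continuous_fnValue (A : Matrix m n C(X, ℂ)) : Continuous (fnValue A) :=
  continuous_matrix fun i j => (A i j).continuous

theorem fnValue_injective : Function.Injective (fnValue : Matrix m n C(X, ℂ) → _) := by
  intro A B h
  ext i j x
  exact congrFun (congrFun (congrFun h x) i) j

theorem fnValue_mul [Fintype m] (A : Matrix l m C(X, ℂ)) (B : Matrix m n C(X, ℂ)) (x : X) :
    fnValue (A * B) x = fnValue A x * fnValue B x := by
  ext i j
  simp [fnValue, Matrix.mul_apply]

theorem idemEquiv_iff_exists_fn [Fintype m] [Fintype n] {e : Matrix m m C(X, ℂ)}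
    {f : Matrix n n C(X, ℂ)} : IdemEquiv e f ↔ ∃ (a : X → Matrix m n ℂ) (b : X → Matrix n m ℂ),
      Continuous a ∧ Continuous b ∧ (∀ x, a x * b x = fnValue e x) ∧
        ∀ x, b x * a x = fnValue f x := by
  constructor
  · rintro ⟨a, b, rfl, rfl⟩
    exact ⟨_, _, continuous_fnValue a, continuous_fnValue b, fun x => (fnValue_mul _ _ x).symm,
      fun x => (fnValue_mul _ _ x).symm⟩
  · rintro ⟨a, b, ha, hb, h1, h2⟩
    refine ⟨fnMatrix a ha, fnMatrix b hb, fnValue_injective (funext fun x => ?_),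
      fnValue_injective (funext fun x => ?_)⟩
    · rw [fnValue_mul]; exact h1 x
    · rw [fnValue_mul]; exact h2 x

/-- An equivalence of idempotents can be normalised. -/
theorem IdemEquiv.exists_normalised {R : Type*} [CommRing R] [Fintype m] [Fintype n]
    {e : Matrix m m R} {f : Matrix n n R} (he : e * e = e) (hf : f * f = f) (h : IdemEquiv e f) :
    ∃ (a : Matrix m n R) (b : Matrix n m R), a * b = e ∧ b * a = f ∧ e * a = a ∧ a * f = a ∧
      f * b = b ∧ b * e = b := by
  obtain ⟨a, b, rfl, rfl⟩ := h
  have h1 : a * b * (a * b * a) = a * b * a := by rw [← Matrix.mul_assoc, he]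
  have h2 : a * b * a * (b * a) = a * b * a := by
    rw [Matrix.mul_assoc a b a, Matrix.mul_assoc, hf]
  have h3 : b * a * (b * a * b) = b * a * b := by rw [← Matrix.mul_assoc, hf]
  have h4 : b * a * b * (a * b) = b * a * b := by
    rw [Matrix.mul_assoc b a b, Matrix.mul_assoc, he]
  refine ⟨a * b * a, b * a * b, ?_, ?_, h1, h2, h3, h4⟩
  · rw [← Matrix.mul_assoc, h2, Matrix.mul_assoc, he]
  · rw [← Matrix.mul_assoc, h4, Matrix.mul_assoc, hf]

end FunctionMatrices

/-! ### Homotopy invariance of classes of idempotents. -/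

section VHomotopy

variable {X Y Z : Type*} [TopologicalSpace X] [TopologicalSpace Y] [TopologicalSpace Z] {N : ℕ}

/-- The class in `V(C(X))` of a continuous idempotent-valued function. -/
def vClass (A : X → Matrix (Fin N) (Fin N) ℂ) (hA : Continuous A) (h : ∀ x, A x * A x = A x) :
    VMonoid C(X, ℂ) :=
  Quotient.mk _ ⟨N, fnMatrix A hA, fnValue_injective (funext fun x => by
    rw [fnValue_mul, fnValue_fnMatrix, h])⟩

theorem exists_eq_vClass (v : VMonoid C(X, ℂ)) : ∃ (N : ℕ) (A : X → Matrix (Fin N) (Fin N) ℂ)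
    (hA : Continuous A) (h : ∀ x, A x * A x = A x), v = vClass A hA h := by
  obtain ⟨e⟩ := v
  exact ⟨e.size, fnValue e.mat, continuous_fnValue _, fun x => by rw [← fnValue_mul, e.idem], rfl⟩

theorem vClass_eq {M N : ℕ} {A : X → Matrix (Fin N) (Fin N) ℂ} {hA : Continuous A}
    {h : ∀ x, A x * A x = A x} {B : X → Matrix (Fin M) (Fin M) ℂ} {hB : Continuous B}
    {h' : ∀ x, B x * B x = B x} (a : X → Matrix (Fin N) (Fin M) ℂ)
    (b : X → Matrix (Fin M) (Fin N) ℂ) (ha : Continuous a) (hb : Continuous b)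
    (h1 : ∀ x, a x * b x = A x) (h2 : ∀ x, b x * a x = B x) :
    vClass A hA h = vClass B hB h' :=
  Quotient.sound (idemEquiv_iff_exists_fn.2 ⟨a, b, ha, hb, h1, h2⟩)

theorem exists_of_vClass_eq {M N : ℕ} {A : X → Matrix (Fin N) (Fin N) ℂ} {hA : Continuous A}
    {h : ∀ x, A x * A x = A x} {B : X → Matrix (Fin M) (Fin M) ℂ} {hB : Continuous B}
    {h' : ∀ x, B x * B x = B x} (H : vClass A hA h = vClass B hB h') :
    ∃ (a : X → Matrix (Fin N) (Fin M) ℂ) (b : X → Matrix (Fin M) (Fin N) ℂ),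
      Continuous a ∧ Continuous b ∧ (∀ x, a x * b x = A x) ∧ (∀ x, b x * a x = B x) ∧
      (∀ x, A x * a x = a x) ∧ (∀ x, a x * B x = a x) ∧ (∀ x, B x * b x = b x) ∧
      ∀ x, b x * A x = b x := by
  obtain ⟨a, b, h1, h2, h3, h4, h5, h6⟩ := (Quotient.exact H).exists_normalised
    (IdemMatrix.idem _) (IdemMatrix.idem _)
  refine ⟨fnValue a, fnValue b, continuous_fnValue a, continuous_fnValue b, ?_, ?_, ?_, ?_, ?_, ?_⟩
    <;> intro x
  · rw [← fnValue_mul]; exact congrArg (fnValue · x) h1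
  · rw [← fnValue_mul]; exact congrArg (fnValue · x) h2
  · exact (fnValue_mul _ a x).symm.trans (congrArg (fnValue · x) h3)
  · exact (fnValue_mul a _ x).symm.trans (congrArg (fnValue · x) h4)
  · exact (fnValue_mul _ b x).symm.trans (congrArg (fnValue · x) h5)
  · exact (fnValue_mul b _ x).symm.trans (congrArg (fnValue · x) h6)

theorem VMonoid.map_vClass (f : C(X, Y)) (A : Y → Matrix (Fin N) (Fin N) ℂ) (hA : Continuous A)
    (h : ∀ x, A x * A x = A x) :
    VMonoid.map (ContinuousMap.compRightAlgHom ℂ ℂ f).toRingHom (vClass A hA h) =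
      vClass (fun x => A (f x)) (hA.comp f.continuous) (fun x => h (f x)) := rfl

/-- Homotopic continuous families of idempotents over a compact space are equivalent. -/
theorem vClass_eq_of_homotopy [CompactSpace X] (A : I × X → Matrix (Fin N) (Fin N) ℂ)
    (hA : Continuous A) (h : ∀ p, A p * A p = A p) :
    vClass (fun x => A (0, x)) (by fun_prop) (fun x => h _) =
      vClass (fun x => A (1, x)) (by fun_prop) (fun x => h _) := by
  let c : I → VMonoid C(X, ℂ) := fun t => vClass (fun x => A (t, x)) (by fun_prop) (fun x => h _)
  have hc : IsLocallyConstant c := by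
    refine (IsLocallyConstant.iff_eventually_eq c).2 fun s => ?_
    -- This matrix intertwines the idempotents at times `t` and `s`. It is 1 at `t = s`, so by
    -- compactness of `X` it is invertible everywhere for `t` near `s`.
    let w : I × X → Matrix (Fin N) (Fin N) ℂ := fun p =>
      A p * A (s, p.2) + (1 - A p) * (1 - A (s, p.2))
    have hw : Continuous w := by fun_prop
    have hev : ∀ᶠ t in nhds s, ∀ x ∈ (Set.univ : Set X), (w (t, x)).det ≠ 0 := by
      refine isCompact_univ.eventually_forall_of_forall_eventually fun x _ => ?_
      refine (hw.matrix_det.continuousAt (x := (s, x))).eventually_ne ?_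
      have h1 : w (s, x) = 1 := by
        have h2 := h (s, x)
        simp only [w, sub_mul, mul_sub, one_mul, mul_one, h2]
        abel
      rw [h1, Matrix.det_one]
      exact one_ne_zero
    filter_upwards [hev] with t ht
    let u : C(X, GL (Fin N) ℂ) := glMap (fun x => w (t, x)) (by fun_prop) fun x => ht x trivial
    have h1 : ∀ x, A (t, x) * (u x).1 = (u x).1 * A (s, x) := by
      intro x
      change A (t, x) * w (t, x) = w (t, x) * A (s, x)
      simp only [w, mul_add, add_mul, sub_mul, mul_sub, one_mul, mul_one, ← mul_assoc, h]
      simp only [mul_assoc, h]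
      abel
    refine vClass_eq (fun x => (u x).1 * A (s, x)) (fun x => A (s, x) * (u⁻¹ x).1)
      ((continuous_glVal u).mul (by fun_prop)) (.mul (by fun_prop) (continuous_glVal u⁻¹))
      (fun x => ?_) (fun x => ?_)
    · rw [mul_assoc, ← mul_assoc (A _), h, ← mul_assoc, ← h1, mul_assoc]
      change A (t, x) * ((u x).1 * ((u x)⁻¹).1) = _
      rw [Units.mul_inv, mul_one]
    · change A (s, x) * ((u x)⁻¹).1 * ((u x).1 * A (s, x)) = _
      rw [mul_assoc, Units.inv_mul_cancel_left, h]
  exact hc.apply_eq_of_preconnectedSpace 0 1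

end VHomotopy

/-! ## Functoriality and homotopy invariance of `K⁰` -/

section KZeroHomotopy

variable {X Y Z : Type*} [TopologicalSpace X] [TopologicalSpace Y] [TopologicalSpace Z]

theorem grothendieckLift_of {M G : Type*} [AddCommMonoid M] [AddCommGroup G] (f : M →+ G) (x : M) :
    Algebra.GrothendieckAddGroup.lift f (Algebra.GrothendieckAddGroup.of x) = f x :=
  DFunLike.congr_fun (Algebra.GrothendieckAddGroup.lift.symm_apply_apply f) x

theorem grothendieck_hom_ext {M G : Type*} [AddCommMonoid M] [AddCommGroup G]
    {f g : Algebra.GrothendieckAddGroup M →+ G}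
    (h : ∀ x, f (Algebra.GrothendieckAddGroup.of x) = g (Algebra.GrothendieckAddGroup.of x)) :
    f = g :=
  Algebra.GrothendieckAddGroup.lift.symm.injective (AddMonoidHom.ext h)

theorem KZero.map_of (f : C(X, Y)) (v : VMonoid C(Y, ℂ)) :
    KZero.map f (Algebra.GrothendieckAddGroup.of v) = Algebra.GrothendieckAddGroup.of
      (VMonoid.map (ContinuousMap.compRightAlgHom ℂ ℂ f).toRingHom v) :=
  grothendieckLift_of _ v

theorem KZero.map_map (f : C(X, Y)) (g : C(Y, Z)) (α : KZero Z) :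
    KZero.map f (KZero.map g α) = KZero.map (g.comp f) α := by
  refine DFunLike.congr_fun (grothendieck_hom_ext (f := (KZero.map f).comp (KZero.map g))
    fun v => ?_) α
  obtain ⟨N, A, hA, h, rfl⟩ := exists_eq_vClass v
  rw [AddMonoidHom.comp_apply, KZero.map_of, KZero.map_of, KZero.map_of]
  rfl

theorem KZero.map_id (α : KZero X) : KZero.map (ContinuousMap.id X) α = α := by
  refine DFunLike.congr_fun (grothendieck_hom_ext (g := AddMonoidHom.id _) fun v => ?_) α
  obtain ⟨N, A, hA, h, rfl⟩ := exists_eq_vClass v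
  rw [KZero.map_of]
  rfl

theorem KZero.map_eq_of_homotopic [CompactSpace X] {f g : C(X, Y)} (H : f.Homotopic g) :
    KZero.map f = KZero.map g := by
  refine grothendieck_hom_ext fun v => ?_
  obtain ⟨N, A, hA, h, rfl⟩ := exists_eq_vClass v
  obtain ⟨F⟩ := H
  rw [KZero.map_of, KZero.map_of, VMonoid.map_vClass, VMonoid.map_vClass]
  have := vClass_eq_of_homotopy (fun p => A (F p)) (by fun_prop) fun p => h _
  simp only [F.apply_zero, F.apply_one] at this
  rw [this]

theorem KZero.map_bijective [CompactSpace X] [CompactSpace Y] (f : C(X, Y)) (g : C(Y, X))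
    (h : (g.comp f).Homotopic (.id X)) (h' : (f.comp g).Homotopic (.id Y)) :
    Function.Bijective (KZero.map f) := by
  refine Function.bijective_iff_has_inverse.2 ⟨KZero.map g, fun α => ?_, fun α => ?_⟩
  · rw [KZero.map_map, KZero.map_eq_of_homotopic h', KZero.map_id]
  · rw [KZero.map_map, KZero.map_eq_of_homotopic h, KZero.map_id]

/-- The class in `V(R)` of the free module of rank `r`. -/
def VMonoid.free (R : Type*) [CommRing R] (r : ℕ) : VMonoid R := Quotient.mk _ ⟨r, 1, one_mul 1⟩

theorem KZero.one_eq (X : Type*) [TopologicalSpace X] :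
    KZero.one X = Algebra.GrothendieckAddGroup.of (VMonoid.free C(X, ℂ) 1) := rfl

theorem KZero.map_one (f : C(X, Y)) : KZero.map f (KZero.one Y) = KZero.one X := by
  rw [KZero.one_eq, KZero.map_of]
  refine congrArg _ (congrArg (Quotient.mk _) ?_)
  simp only [IdemMatrix.map]
  congr 1
  exact Matrix.map_one _ (_root_.map_zero _) (_root_.map_one _)

end KZeroHomotopy

/-! ## `K⁰` of the circle -/

section KZeroCircle

theorem VMonoid.free_eq_nsmul (R : Type*) [CommRing R] (r : ℕ) :
    VMonoid.free R r = r • VMonoid.free R 1 := by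
  induction r with
  | zero =>
    rw [zero_nsmul]
    refine congrArg (Quotient.mk _) ?_
    simp only [IdemMatrix.zero]
    congr 1
    exact Subsingleton.elim _ _
  | succ r ih =>
    rw [succ_nsmul, ← ih]
    refine congrArg (Quotient.mk _) (?_ : _ = IdemMatrix.sum _ _)
    simp only [IdemMatrix.sum]
    congr 1
    rw [Matrix.fromBlocks_one, Matrix.submatrix_one_equiv]

/-- A projection factors as the inclusion of its range after the corestriction; in the other order
they compose to the identity of the range. -/
theorem exists_idemEquiv_one {K : Type*} [Field K] {N : ℕ} (e : Matrix (Fin N) (Fin N) K)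
    (he : e * e = e) : ∃ r : ℕ, IdemEquiv e (1 : Matrix (Fin r) (Fin r) K) := by
  let f := Matrix.toLin' e
  have hf : f ∘ₗ f = f := by rw [← Matrix.toLin'_mul, he]
  let V := LinearMap.range f
  let b := Module.finBasis K V
  let s := Pi.basisFun K (Fin N)
  refine ⟨Module.finrank K V, LinearMap.toMatrix b s V.subtype, LinearMap.toMatrix s b f.rangeRestrict,
    ?_, ?_⟩
  · rw [← LinearMap.toMatrix_comp, LinearMap.subtype_comp_codRestrict, LinearMap.toMatrix_eq_toMatrix',
      LinearMap.toMatrix'_toLin']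
  · rw [← LinearMap.toMatrix_comp, ← LinearMap.toMatrix_id b]
    congr 1
    ext ⟨x, y, rfl⟩ : 2
    exact LinearMap.congr_fun hf y

/-- Every vector bundle on the circle is trivial. -/
theorem exists_vClass_circle_eq (v : VMonoid C(Circle, ℂ)) :
    ∃ r : ℕ, v = r • VMonoid.free C(Circle, ℂ) 1 := by
  obtain ⟨N, S, hS, h, rfl⟩ := exists_eq_vClass v
  let E : I → Matrix (Fin N) (Fin N) ℂ := fun t => S (circleLoop t)
  have hE : Continuous E := by fun_prop
  have hE' : ∀ t, E t * E t = E t := fun t => h _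
  let e := S 1
  have he : e * e = e := h 1
  have hE0 : E 0 = e := congrArg S circleLoop_zero
  have hE1 : E 1 = e := congrArg S circleLoop_one
  -- Contracting the interval trivialises the pulled-back bundle.
  have h1 : vClass E hE hE' = vClass (fun _ => e) continuous_const (fun _ => he) := by
    have := vClass_eq_of_homotopy (fun p : I × I => E (p.1 * p.2)) (by fun_prop) fun _ => hE' _
    simp only [zero_mul, one_mul, hE0] at this
    exact this.symm
  obtain ⟨a, b, ha, hb, hab, hba, hEa, hae, heb, hbE⟩ := exists_of_vClass_eq h1
  -- Multiplication by `b 0` normalises the trivialisation to be `e` at time 0, so `a' 1` is the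
  -- gluing automorphism of the image of `e`.
  let a' : I → Matrix (Fin N) (Fin N) ℂ := fun t => a t * b 0
  let b' : I → Matrix (Fin N) (Fin N) ℂ := fun t => a 0 * b t
  have h0 : a 0 * b 0 = e := (hab 0).trans hE0
  have hab' : ∀ t, a' t * b' t = E t := by
    intro t
    change a t * b 0 * (a 0 * b t) = E t
    rw [← mul_assoc, mul_assoc (a t), hba, hae, hab]
  have hba' : ∀ t, b' t * a' t = e := by
    intro t
    change a 0 * b t * (a t * b 0) = e
    rw [← mul_assoc, mul_assoc (a 0), hba, hae, h0]
  have hk0 : e * a' 1 = a' 1 := by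
    change e * (a 1 * b 0) = a 1 * b 0
    rw [← mul_assoc, ← hE1, hEa]
  have hk1 : a' 1 * e = a' 1 := by
    change a 1 * b 0 * e = a 1 * b 0
    rw [mul_assoc, ← hE0, hbE]
  have hl0 : e * b' 1 = b' 1 := by
    change e * (a 0 * b 1) = a 0 * b 1
    rw [← mul_assoc, ← hE0, hEa]
  have hl1 : b' 1 * e = b' 1 := by
    change a 0 * b 1 * e = a 0 * b 1
    rw [mul_assoc, ← hE1, hbE]
  have hkl : a' 1 * b' 1 = e := (hab' 1).trans hE1
  have hlk : b' 1 * a' 1 = e := hba' 1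
  -- The gluing automorphism is extended by the identity on the image of `1 - e`, so that it has a
  -- path to 1 in the full linear group.
  let K : GL (Fin N) ℂ := ⟨a' 1 + (1 - e), b' 1 + (1 - e),
    by simp only [mul_add, add_mul, mul_sub, sub_mul, mul_one, one_mul, hkl, hk1, hl0, he]; abel,
    by simp only [mul_add, add_mul, mul_sub, sub_mul, mul_one, one_mul, hlk, hk0, hl1, he]; abel⟩
  have hKe : K.1 * e = a' 1 := by
    change (a' 1 + (1 - e)) * e = a' 1
    simp only [add_mul, sub_mul, one_mul, hk1, he]
    abel
  have heK : e * K.1 = a' 1 := by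
    change e * (a' 1 + (1 - e)) = a' 1
    simp only [mul_add, mul_sub, mul_one, hk0, he]
    abel
  have hKb : K.1 * b' 1 = e := by
    rw [← hl0, ← mul_assoc, hKe, hkl]
  obtain ⟨γ, hγ0, hγ1, hγ⟩ := exists_path_in_bicommutant K
  have hγe : ∀ t, (γ t).1 * e = e * (γ t).1 := fun t => hγ t e (hKe.trans heK.symm)
  -- Since `K` commutes with `e`, so does the whole path `γ`. Dividing the trivialisation by `γ`
  -- makes it equal to `e` at both ends, so it descends to the circle.
  obtain ⟨p, hp⟩ := exists_circle_descent (Y := Matrix (Fin N) (Fin N) ℂ)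
    ⟨fun t => a' t * (γ⁻¹ t).1, .mul (by fun_prop) (continuous_glVal γ⁻¹)⟩ (by
      change a 0 * b 0 * ((γ 0)⁻¹).1 = a' 1 * ((γ 1)⁻¹).1
      rw [hγ0, hγ1, h0, inv_one, ← heK, Units.mul_inv_cancel_right]
      exact mul_one e)
  obtain ⟨q, hq⟩ := exists_circle_descent (Y := Matrix (Fin N) (Fin N) ℂ)
    ⟨fun t => (γ t).1 * b' t, .mul (continuous_glVal γ) (by fun_prop)⟩ (by
      change (γ 0).1 * (a 0 * b 0) = (γ 1).1 * b' 1
      rw [hγ0, hγ1, h0, hKb]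
      exact one_mul e)
  have h2 : vClass S hS h = vClass (fun _ => e) continuous_const (fun _ => he) := by
    refine vClass_eq p q p.continuous q.continuous (fun z => ?_) (fun z => ?_) <;>
      obtain ⟨t, rfl⟩ := isQuotientMap_circleLoop.surjective z <;> rw [hp, hq]
    · change a' t * ((γ t)⁻¹).1 * ((γ t).1 * b' t) = E t
      rw [mul_assoc, Units.inv_mul_cancel_left, hab']
    · change (γ t).1 * b' t * (a' t * ((γ t)⁻¹).1) = e
      rw [mul_assoc, ← mul_assoc (b' t), hba', ← mul_assoc, hγe, Units.mul_inv_cancel_right]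
  obtain ⟨r, hr⟩ := exists_idemEquiv_one e he
  refine ⟨r, h2.trans ?_⟩
  rw [← VMonoid.free_eq_nsmul]
  refine Quotient.sound (?_ : IdemEquiv _ _)
  have h3 := hr.map (algebraMap ℂ C(Circle, ℂ))
  rw [Matrix.map_one _ (map_zero _) (map_one _)] at h3
  exact h3

/-- The trace of an idempotent matrix, as a homomorphism on `V(R)`. -/
def vTrace (R : Type*) [CommRing R] : VMonoid R →+ R where
  toFun := Quotient.lift (fun e => e.mat.trace) (by
    rintro e f ⟨a, b, h1, h2⟩
    rw [← h1, ← h2, Matrix.trace_mul_comm])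
  map_zero' := by
    change Matrix.trace (0 : Matrix (Fin 0) (Fin 0) R) = 0
    simp
  map_add' := by
    rintro ⟨e⟩ ⟨f⟩
    change Matrix.trace ((Matrix.fromBlocks e.mat 0 0 f.mat).submatrix _ _) = e.mat.trace + f.mat.trace
    refine (Equiv.sum_comp finSumFinEquiv.symm fun i => Matrix.fromBlocks e.mat 0 0 f.mat i i).trans ?_
    rw [Fintype.sum_sum_type]
    rfl

theorem exists_zsmul_kZero_one_eq (α : KZero Circle) : ∃ k : ℤ, k • KZero.one Circle = α := by
  induction α using AddLocalization.ind with
  | H y =>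
    obtain ⟨v, w, hw⟩ := y
    obtain ⟨r, rfl⟩ := exists_vClass_circle_eq v
    obtain ⟨s, rfl⟩ := exists_vClass_circle_eq w
    refine ⟨r - s, ?_⟩
    have h1 : (AddLocalization.mk (r • VMonoid.free C(Circle, ℂ) 1)
        ⟨s • VMonoid.free C(Circle, ℂ) 1, hw⟩ : KZero Circle) =
        Algebra.GrothendieckAddGroup.of (r • VMonoid.free C(Circle, ℂ) 1) -
        Algebra.GrothendieckAddGroup.of (s • VMonoid.free C(Circle, ℂ) 1) := by
      rw [eq_sub_iff_add_eq, AddLocalization.mk_eq_addMonoidOf_mk'_apply]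
      exact (AddLocalization.addMonoidOf (⊤ : AddSubmonoid (VMonoid C(Circle, ℂ)))).mk'_spec _ _
    have h2 (k : ℕ) : (Algebra.GrothendieckAddGroup.of (k • VMonoid.free C(Circle, ℂ) 1) :
        KZero Circle) = k • KZero.one Circle := AddMonoidHom.map_nsmul _ _ _
    rw [h1, h2, h2, sub_zsmul, natCast_zsmul, natCast_zsmul, sub_eq_add_neg]

/-- The trace sends the trivial line bundle to the constant function 1, which has infinite additive
order. -/
theorem zsmul_kZero_one_eq_zero {k : ℤ} (h : k • KZero.one Circle = 0) : k = 0 := by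
  have h1 := congrArg (Algebra.GrothendieckAddGroup.lift (vTrace C(Circle, ℂ))) h
  have h2 : Algebra.GrothendieckAddGroup.lift (vTrace C(Circle, ℂ)) (KZero.one Circle) = 1 := by
    refine (grothendieckLift_of _ _).trans ?_
    change Matrix.trace (1 : Matrix (Fin 1) (Fin 1) C(Circle, ℂ)) = 1
    simp
  rw [map_zsmul, _root_.map_zero, h2] at h1
  simpa using DFunLike.congr_fun h1 1

theorem exists_kZeroCircle_equiv : ∃ e : KZero Circle ≃+ ℤ, e (KZero.one Circle) = 1 := by
  let φ : ℤ ≃+ KZero Circle := AddEquiv.ofBijective (zmultiplesHom _ (KZero.one Circle))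
    ⟨(injective_iff_map_eq_zero _).2 fun k hk => zsmul_kZero_one_eq_zero hk, exists_zsmul_kZero_one_eq⟩
  refine ⟨φ.symm, φ.symm_apply_eq.2 ?_⟩
  exact (one_zsmul _).symm

theorem KZero.map_circle_self (f : C(Circle, Circle)) (α : KZero Circle) :
    KZero.map f α = α := by
  obtain ⟨k, rfl⟩ := exists_zsmul_kZero_one_eq α
  rw [map_zsmul, KZero.map_one]

end KZeroCircle

/-! ## `K`-theory of the compact orbits -/

section CompactOrbitK

variable {Y : Type*} [TopologicalSpace Y] {n : ℕ}

theorem prodCoord_homotopies (hn : 1 ≤ n) (θ : Y ≃ₜ SymCircle n) : ∃ g : C(Circle, Y),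
    (g.comp (prodCoord θ)).Homotopic (.id Y) ∧ ((prodCoord θ).comp g).Homotopic (.id Circle) := by
  let h := symHomotopyEquiv hn
  let s : C(Y, SymCircle n) := θ
  let t : C(SymCircle n, Y) := θ.symm
  refine ⟨t.comp h.invFun, ?_, ?_⟩
  · have h1 := ((ContinuousMap.Homotopic.refl t).comp h.left_inv).comp (.refl s)
    have h2 : (t.comp (.id _)).comp s = .id Y := ContinuousMap.ext fun y => θ.symm_apply_apply y
    rw [h2] at h1
    exact h1
  · have h2 : (prodCoord θ).comp (t.comp h.invFun) = h.toFun.comp h.invFun :=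
      ContinuousMap.ext fun z => congrArg (symProd n) (θ.apply_symm_apply _)
    rw [h2]
    exact h.right_inv

theorem kOne_prodCoord_bijective (hn : 1 ≤ n) (θ : Y ≃ₜ SymCircle n) :
    Function.Bijective (KOne.map (prodCoord θ)) := by
  obtain ⟨g, h, h'⟩ := prodCoord_homotopies hn θ
  exact KOne.map_bijective _ g h h'

theorem kZero_prodCoord_bijective (hn : 1 ≤ n) (θ : Y ≃ₜ SymCircle n) :
    Function.Bijective (KZero.map (prodCoord θ)) := by
  have : CompactSpace Y := θ.symm.compactSpace
  obtain ⟨g, h, h'⟩ := prodCoord_homotopies hn θ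
  exact KZero.map_bijective _ g h h'

theorem symProd_symPow (f : ℕ) (c : SymCircle n) : symProd n (symPow n f c) = symProd n c ^ f := by
  obtain ⟨z⟩ := c
  exact Finset.prod_pow Finset.univ f z

end CompactOrbitK

end BaseChangeK

end

theorem mainTheorem6
    {F E Ω : Type*} [Field F] [ValuativeRel F] [TopologicalSpace F] [IsNonarchimedeanLocalField F]
    [Field E] [Algebra F E] [FiniteDimensional F E] [IsGalois F E]
    [Field Ω] [Algebra F Ω] [Algebra E Ω] [IsScalarTower F E Ω] [IsSepClosure F Ω]
    (n : ℕ) (hn : 1 ≤ n) (ρ : WeilGroup 𝒪[F] F Ω →ₜ* Circle) :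
    -- both Weil groups contain geometric Frobenius elements
    (∃ Φ, IsGeomFrob 𝒪[F] F Ω Φ) ∧
    (∃ Φ, IsGeomFrob (ringOfIntegers F E) E Ω Φ) ∧
    -- the product map is a homotopy equivalence
    (∃ h : ContinuousMap.HomotopyEquiv (SymCircle n) Circle, h.toFun = symProd n) ∧
    -- the K-groups of the circle
    Nonempty (KOne Circle ≃+ ℤ) ∧
    (∃ e : KZero Circle ≃+ ℤ, e (KZero.one Circle) = 1) ∧
    -- base change
    ∀ (Φ_F : WeilGroup 𝒪[F] F Ω) (Φ_E : WeilGroup (ringOfIntegers F E) E Ω),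
      IsGeomFrob 𝒪[F] F Ω Φ_F → IsGeomFrob (ringOfIntegers F E) E Ω Φ_E →
      ∃ (θ_F : CompactOrbit 𝒪[F] F Ω n ρ ≃ₜ SymCircle n)
        (θ_E : CompactOrbit (ringOfIntegers F E) E Ω n (ρ.comp (weilInclusion F E Ω)) ≃ₜ
          SymCircle n),
        (∀ ψ, θ_F (CompactOrbit.mk 𝒪[F] F Ω n ρ ψ) = SymCircle.mk fun i => (ψ i).1 Φ_F) ∧
        (∀ ψ, θ_E (CompactOrbit.mk (ringOfIntegers F E) E Ω n (ρ.comp (weilInclusion F E Ω)) ψ) =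
          SymCircle.mk fun i => (ψ i).1 Φ_E) ∧
        (∀ c, θ_E (baseChange F E Ω n ρ c) = symPow n (residueDegree F E) (θ_F c)) ∧
        -- the K-groups of the compact orbits are those of the circle
        Function.Bijective (KOne.map (prodCoord θ_F)) ∧
        Function.Bijective (KOne.map (prodCoord θ_E)) ∧
        Function.Bijective (KZero.map (prodCoord θ_F)) ∧
        Function.Bijective (KZero.map (prodCoord θ_E)) ∧
        -- base change is multiplication by `f` on `K¹` and the identity on `K⁰`
        (∀ α : KOne Circle,
          KOne.map (baseChange F E Ω n ρ) (KOne.map (prodCoord θ_E) α) =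
            residueDegree F E • KOne.map (prodCoord θ_F) α) ∧
        (∀ α : KZero Circle,
          KZero.map (baseChange F E Ω n ρ) (KZero.map (prodCoord θ_E) α) =
            KZero.map (prodCoord θ_F) α) := by
  refine ⟨exists_isGeomFrob_base F Ω, exists_isGeomFrob_extension F E Ω,
    ⟨symHomotopyEquiv hn, rfl⟩, ⟨kOneCircleEquiv⟩, exists_kZeroCircle_equiv, ?_⟩
  intro Φ_F Φ_E hF hE
  have : IsSepClosed Ω := IsSepClosure.sep_closed F
  have : Algebra.IsAlgebraic F Ω := Algebra.IsSeparable.isAlgebraic F Ω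
  have := finite_residue F
  have := finite_residue_ringOfIntegers F E
  have := isLocalRing_integralClosure F Ω
  have := isLocalRing_integralClosure F E
  have := isLocalRing_integralClosure_ringOfIntegers F E Ω
  obtain ⟨θ_F, hθF⟩ := exists_orbit_homeomorph n ρ hF
  obtain ⟨θ_E, hθE⟩ := exists_orbit_homeomorph n (ρ.comp (weilInclusion F E Ω)) hE
  have hbc : ∀ c, θ_E (baseChange F E Ω n ρ c) = symPow n (residueDegree F E) (θ_F c) := by
    rintro ⟨_, ψ, rfl⟩
    refine (hθE fun i => restrictUnramified F E Ω (ψ i)).trans ?_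
    refine Eq.trans ?_ (congrArg (symPow n (residueDegree F E)) (hθF ψ)).symm
    exact congrArg SymCircle.mk (funext fun i => unramified_weilInclusion hF hE (ψ i))
  -- The commutative square which reduces both K-theory statements to the power map of the circle.
  have hcomm : (prodCoord θ_E).comp (baseChange F E Ω n ρ) =
      (circlePowMap (residueDegree F E)).comp (prodCoord θ_F) :=
    ContinuousMap.ext fun c => (congrArg (symProd n) (hbc c)).trans (symProd_symPow _ _)
  refine ⟨θ_F, θ_E, hθF, hθE, hbc, kOne_prodCoord_bijective hn θ_F, kOne_prodCoord_bijective hn θ_E,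
    kZero_prodCoord_bijective hn θ_F, kZero_prodCoord_bijective hn θ_E, fun α => ?_, fun α => ?_⟩
  · rw [KOne.map_map, hcomm, ← KOne.map_map, KOne.map_circlePowMap, map_nsmul]
  · rw [KZero.map_map, hcomm, ← KZero.map_map, KZero.map_circle_self]
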